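/- Let $f:[0,1]\to(0,1)$ be a $C^3$ function all of whose fixed points are isolated, and suppose $f\ge 1/2$ on $[0,1]$. For $a\in[0,1]$ and $l>0$, an urn process associated to $f$ started from $(a,l)$ is a random sequence $(\alpha_n)_{n\ge0}$ with $\alpha_0=a$ such that, conditionally on $\alpha_0,\dots,\alpha_n$, a red ball is drawn with probability $f(\alpha_n)$, in which case $\alpha_{n+1}=\frac{(l+n)\alpha_n+1}{l+n+1}$, and a blue ball is drawn with probability $1-f(\alpha_n)$, in which case $\alpha_{n+1}=\frac{(l+n)\alpha_n}{l+n+1}$. Let $w_0=(\alpha_0^x,l_0^x)_{x\in\mathbb Z}\in([0,1]\times(0,\infty))^{\mathbb Z}$ be an initial environment with $w_0^x=w_0^1$ for all $x\ge1$, and let $(\alpha^x_n)_{n\ge0}$, $x\in\mathbb Z$, be independent urn processes associated to $f$, the one at $x$ being started from $w_0^x$. Let $(X_n)_{n\ge0}$ be the generalized reinforced random walk on $\mathbb Z$ driven by these urns: $X_0=0$, and if $X_n=x$ and the walk has visited $x$ exactly $k$ times strictly before time $n$, then $X_{n+1}=x+1$ if the ball drawn from the urn at $x$ in its step from $\alpha^x_k$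 to $\alpha^x_{k+1}$ is red, and $X_{n+1}=x-1$ otherwise. Put $\delta^1_\infty=\sum_{k=0}^\infty\bigl(2f(\alpha^1_k)-1\bigr)\in[0,\infty]$. Call the walk recurrent if almost surely it visits every site of $\mathbb Z$ infinitely often, and transient if almost surely it converges to $+\infty$ or to $-\infty$. Then $(X_n)_{n\ge0}$ is either recurrent or transient, and it is recurrent if and only if $\mathbb E[\delta^1_\infty]\le1$. -/

import Mathlib

open Set Filter Topology MeasureTheory ProbabilityTheory

/-- Proportion of red balls after a red draw, from an urn with proportion `a` of red balls and
`l` balls in total. -/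
noncomputable def redUpdate (a l : ℝ) : ℝ := (l * a + 1) / (l + 1)

/-- Proportion of red balls after a blue draw, from an urn with proportion `a` of red balls and
`l` balls in total. -/
noncomputable def blueUpdate (a l : ℝ) : ℝ := l * a / (l + 1)

/-- The σ-algebra generated by `α 0, …, α n`. -/
abbrev history {Ω : Type*} (α : ℕ → Ω → ℝ) (n : ℕ) : MeasurableSpace Ω :=
  ⨆ j ∈ Set.Iic n, MeasurableSpace.comap (α j) inferInstance

/-- `α` is (the first coordinate of) an urn process associated to `f`, started with a proportion
`a` of red balls and total weight `l`. The total weight at time `n` is `l + n`; conditionally on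
`α 0, …, α n` the next ball is red with probability `f (α n)` and blue with probability
`1 - f (α n)`. -/
structure IsUrnProcess {Ω : Type*} [MeasurableSpace Ω] (μ : Measure Ω) (f : ℝ → ℝ) (a l : ℝ)
    (α : ℕ → Ω → ℝ) : Prop where
  measurable : ∀ n, Measurable (α n)
  init : ∀ᵐ ω ∂μ, α 0 ω = a
  red : ∀ n : ℕ, μ⟦{ω | α (n + 1) ω = redUpdate (α n ω) (l + n)} | history α n⟧
    =ᵐ[μ] fun ω => f (α n ω)
  blue : ∀ n : ℕ, μ⟦{ω | α (n + 1) ω = blueUpdate (α n ω) (l + n)} | history α n⟧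
    =ᵐ[μ] fun ω => 1 - f (α n ω)

/-- The number of visits of the path `X` to the site `x` strictly before time `n`. -/
def visits (X : ℕ → ℤ) (x : ℤ) (n : ℕ) : ℕ := ((Finset.range n).filter (fun k => X k = x)).card

open Classical in
/-- `X` is the generalized reinforced random walk associated to `f`, started at the site `x₀` with
initial environment `(a₀ x, l₀ x)` at each site `x`, and driven by the independent urn processes
`α x`, one at each site: the `k`-th departure (counted from `0`) from a site is to the
right if the `k`-th ball drawn from the urn at this site is red, and to the left otherwise. -/
structure IsReinforcedWalk {Ω : Type*} [MeasurableSpace Ω] (μ : Measure Ω) (f : ℝ → ℝ)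
    (a₀ l₀ : ℤ → ℝ) (x₀ : ℤ) (α : ℤ → ℕ → Ω → ℝ) (X : ℕ → Ω → ℤ) : Prop where
  urn : ∀ x, IsUrnProcess μ f (a₀ x) (l₀ x) (α x)
  indep : iIndepFun (fun (x : ℤ) (ω : Ω) (n : ℕ) => α x n ω) μ
  start : ∀ ω, X 0 ω = x₀
  step : ∀ (n : ℕ) (ω : Ω) (x : ℤ) (k : ℕ), X n ω = x → visits (fun m => X m ω) x n = k →
    X (n + 1) ω =
      if α x (k + 1) ω = redUpdate (α x k ω) (l₀ x + k) then x + 1 else x - 1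

/-- The path visits every site infinitely often. -/
def IsRecurrentPath (X : ℕ → ℤ) : Prop := ∀ x : ℤ, ∃ᶠ n in atTop, X n = x

/-- The path converges to `+∞` or to `-∞`. -/
def IsTransientPath (X : ℕ → ℤ) : Prop := Tendsto X atTop atTop ∨ Tendsto X atTop atBot

/-- The total drift `∑ₖ (2 f(αₖ) - 1)` of an urn, for `f ≥ 1/2`, as an element of `[0, ∞]`. -/
noncomputable def totalDrift (f : ℝ → ℝ) (α : ℕ → ℝ) : ENNReal :=
  ∑' k : ℕ, ENNReal.ofReal (2 * f (α k) - 1)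

/-! The walk depends only on the sequence of colours drawn at each site. Just before the first
passage at `x + j`, with `x ≥ 0`, the edge from `x` to `x + 1` has been crossed rightwards once more
than leftwards, and the last departure from `x` was to the right. So if `y` left jumps were made
from `x + 1`, those made from `x` are the blue draws at `x` before the `(y + 1)`-th red one. This is
the recursion `backward`, whose values `Y_j` increase with `j` to a limit `L` (`backwardLim`). For
sites from `1` on, `L` is infinite if the path is recurrent and finite if it tends to `+∞`.

Almost surely both colours appear infinitely often at every site; then a path is recurrent or tends
to `+∞` or to `-∞`. Reflection exchanges the colours and gives a recursion without drift towards
red, whose limit is infinite (`ae_backwardLim_eq_top_of_le_half`); this excludes `-∞`. Finiteness of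
`L` is a tail event (`ae_backwardLim_zero_one`). Hence the dichotomy, with recurrence equivalent to
`L = ∞` almost surely.

Let `D(y)` be the mean drift of the draws up to the `(y + 1)`-th red one (`driftUpTo`); `D(∞)` is
the mean total drift. Counting red minus blue draws gives `E[Y_{j+1}] = E[Y_j] + 1 - E[D(Y_j)]`. If
`L = ∞`, then `E[D(Y_j)]` increases to `D(∞)`, and `D(∞) > 1` would eventually make `E[Y_j]`
negative (`driftUpTo_top_le_one`).

Conversely, if `D(∞) ≤ 1` then `D(y) < 1` for each finite `y` (`driftUpTo_lt_one`). A finite `L`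
would have a stationary law of the recursion, but possibly infinite mean, so the balance is replaced
by the bounded test functions `(m/(m+1))^L`. Their means `H(m)` satisfy `H(m) ≤ (m+1)/(m+2) H(m+1) +
e/(m+1)` with `e = E[D(L)] < 1`. This forces `H(m) ≤ e (m+1)/m` for `m ≥ 1`, against `H(m) → 1`
(`not_ae_backwardLim_lt_top`). -/

/-! ### Counting colours and the backward recursion -/

/-- The number of red draws among the first `n` draws of the sequence `s` (`true` is red). -/
def reds (n : ℕ) (s : ℕ → Bool) : ℕ := Nat.count (fun k => s k = true) n

/-- The number of blue draws among the first `n` draws of the sequence `s`. -/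
def blues (n : ℕ) (s : ℕ → Bool) : ℕ := Nat.count (fun k => s k = false) n

lemma reds_zero (s : ℕ → Bool) : reds 0 s = 0 := rfl
lemma blues_zero (s : ℕ → Bool) : blues 0 s = 0 := rfl

lemma reds_succ (n : ℕ) (s : ℕ → Bool) : reds (n + 1) s = reds n s + if s n = true then 1 else 0 :=
  Nat.count_succ _ _

lemma blues_succ (n : ℕ) (s : ℕ → Bool) :
    blues (n + 1) s = blues n s + if s n = false then 1 else 0 := Nat.count_succ _ _

lemma reds_mono (s : ℕ → Bool) : Monotone (fun n => reds n s) := Nat.count_monotone _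
lemma blues_mono (s : ℕ → Bool) : Monotone (fun n => blues n s) := Nat.count_monotone _

lemma reds_add_blues (n : ℕ) (s : ℕ → Bool) : reds n s + blues n s = n := by
  induction n with
  | zero => rfl
  | succ n ih => rw [reds_succ, blues_succ]; cases s n <;> simp <;> omega

lemma reds_congr {n : ℕ} {s t : ℕ → Bool} (h : ∀ k < n, s k = t k) : reds n s = reds n t := by
  induction n with
  | zero => rfl
  | succ n ih => rw [reds_succ, reds_succ, ih fun k hk => h k (by omega), h n (by omega)]

lemma blues_congr {n : ℕ} {s t : ℕ → Bool} (h : ∀ k < n, s k = t k) : blues n s = blues n t := by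
  have h1 := reds_add_blues n s
  have h2 := reds_add_blues n t
  have h3 := reds_congr h
  omega

/-- Both colours occur infinitely often. -/
def IsMixed (s : ℕ → Bool) : Prop := ∀ (c : Bool) (n : ℕ), ∃ k, n ≤ k ∧ s k = c

lemma IsMixed.exists_reds {s : ℕ → Bool} (h : IsMixed s) (y : ℕ) :
    ∃ n, reds n s = y ∧ s n = true := by
  have key : ∀ n, ∃ m, n ≤ m ∧ reds m s = reds n s ∧ s m = true := by
    intro n
    have hex := h true n
    classical
    refine ⟨Nat.find hex, (Nat.find_spec hex).1, ?_, (Nat.find_spec hex).2⟩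
    have : ∀ m, n ≤ m → m ≤ Nat.find hex → reds m s = reds n s := by
      intro m hm
      induction m, hm using Nat.le_induction with
      | base => intro _; rfl
      | succ m hm ih =>
        intro hle
        have := Nat.find_min hex (m := m) (by omega)
        rw [reds_succ, ih (by omega)]
        simp [show s m ≠ true from fun hs => this ⟨hm, hs⟩]
    exact this _ (Nat.find_spec hex).1 le_rfl
  induction y with
  | zero =>
    obtain ⟨m, -, h1, h2⟩ := key 0
    exact ⟨m, h1, h2⟩
  | succ y ih =>
    obtain ⟨n, h1, h2⟩ := ih
    obtain ⟨m, -, h3, h4⟩ := key (n + 1)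
    exact ⟨m, by rw [h3, reds_succ, h1, if_pos h2], h4⟩

lemma IsMixed.exists_le_blues {s : ℕ → Bool} (h : IsMixed s) (y : ℕ) : ∃ n, y ≤ blues n s := by
  induction y with
  | zero => exact ⟨0, Nat.zero_le _⟩
  | succ y ih =>
    obtain ⟨n, hn⟩ := ih
    obtain ⟨k, hk, hs⟩ := h false n
    refine ⟨k + 1, ?_⟩
    have := blues_mono s hk
    rw [blues_succ, if_pos hs]
    simp only at this
    omega

/-- The number of blue draws before the `(y + 1)`-th red draw. -/
noncomputable def bluesBefore (s : ℕ → Bool) (y : ℕ∞) : ℕ∞ :=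
  ⨆ n : ℕ, if (reds n s : ℕ∞) ≤ y then (blues n s : ℕ∞) else 0

lemma bluesBefore_mono (s : ℕ → Bool) : Monotone (bluesBefore s) := by
  intro y z hyz
  refine iSup_mono fun n => ?_
  by_cases h : (reds n s : ℕ∞) ≤ y
  · rw [if_pos h, if_pos (h.trans hyz)]
  · rw [if_neg h]; exact zero_le

/-- The red draw at time `n` raises the count, so `reds m s ≤ reds n s` forces `m ≤ n` and the
supremum is attained at `n`. -/
lemma bluesBefore_reds {s : ℕ → Bool} {n : ℕ} (h : s n = true) :
    bluesBefore s (reds n s) = blues n s := by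
  refine le_antisymm (iSup_le fun m => ?_) ?_
  · split_ifs with hm
    · have hmn : m ≤ n := by
        by_contra hlt
        have h1 := reds_mono s (show n + 1 ≤ m by omega)
        simp only [reds_succ, if_pos h] at h1
        have h2 : reds m s ≤ reds n s := by exact_mod_cast hm
        omega
      exact_mod_cast blues_mono s hmn
    · exact zero_le
  · refine le_iSup_of_le n ?_
    rw [if_pos le_rfl]

lemma IsMixed.bluesBefore_lt_top {s : ℕ → Bool} (h : IsMixed s) {y : ℕ∞} (hy : y < ⊤) :
    bluesBefore s y < ⊤ := by
  lift y to ℕ using hy.ne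
  obtain ⟨n, rfl, hn⟩ := h.exists_reds y
  rw [bluesBefore_reds hn]
  exact ENat.natCast_lt_top _

lemma IsMixed.bluesBefore_top {s : ℕ → Bool} (h : IsMixed s) : bluesBefore s ⊤ = ⊤ := by
  rw [ENat.eq_top_iff_forall_ge]
  intro m
  obtain ⟨n, hn⟩ := h.exists_le_blues m
  refine le_iSup_of_le n ?_
  rw [if_pos le_top]
  exact_mod_cast hn

/-- Naturals are compact elements of `ℕ∞`. This is what makes `bluesBefore s` and `driftUpTo`
continuous along increasing limits. -/
lemma natCast_le_iSup_iff {u : ℕ → ℕ∞} (n : ℕ) : (n : ℕ∞) ≤ ⨆ j, u j ↔ ∃ j, (n : ℕ∞) ≤ u j := by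
  constructor
  · intro h
    rcases n with _ | n
    · exact ⟨0, by simp⟩
    · have : (n : ℕ∞) < ⨆ j, u j := lt_of_lt_of_le (by exact_mod_cast Nat.lt_succ_self n) h
      obtain ⟨j, hj⟩ := lt_iSup_iff.1 this
      refine ⟨j, ?_⟩
      have := Order.add_one_le_of_lt hj
      exact_mod_cast this
  · rintro ⟨j, hj⟩
    exact hj.trans (le_iSup u j)

lemma bluesBefore_iSup (s : ℕ → Bool) (u : ℕ → ℕ∞) :
    bluesBefore s (⨆ j, u j) = ⨆ j, bluesBefore s (u j) := by
  refine le_antisymm (iSup_le fun n => ?_) (iSup_le fun j => bluesBefore_mono s (le_iSup u j))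
  split_ifs with h
  · obtain ⟨j, hj⟩ := (natCast_le_iSup_iff _).1 h
    refine le_iSup_of_le j (le_iSup_of_le n ?_)
    rw [if_pos hj]
  · exact zero_le

/-- The numbers of left jumps from the sites `x + j, …, x` before the first passage at `x + j`,
as a backward recursion in terms of the draws `S i` at the sites `x + i`. -/
noncomputable def backward : ℕ → (ℕ → ℕ → Bool) → ℕ∞
  | 0, _ => 0
  | j + 1, S => bluesBefore (S 0) (backward j fun i => S (i + 1))

lemma backward_le_succ (j : ℕ) (S : ℕ → ℕ → Bool) : backward j S ≤ backward (j + 1) S := by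
  induction j generalizing S with
  | zero => exact zero_le
  | succ j ih => exact bluesBefore_mono _ (ih _)

lemma backward_mono (S : ℕ → ℕ → Bool) : Monotone (fun j => backward j S) :=
  monotone_nat_of_le_succ fun j => backward_le_succ j S

/-- The limit of the backward recursion. -/
noncomputable def backwardLim (S : ℕ → ℕ → Bool) : ℕ∞ := ⨆ j, backward j S

/-- Passing to the limit in the recursion: the source of both the tail property and, for identically
distributed sites, stationarity. -/
lemma backwardLim_eq (S : ℕ → ℕ → Bool) :
    backwardLim S = bluesBefore (S 0) (backwardLim fun i => S (i + 1)) := by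
  rw [backwardLim, backwardLim, bluesBefore_iSup]
  refine le_antisymm (iSup_le fun j => ?_) (iSup_le fun j => le_iSup (fun j => backward j S) (j + 1))
  rcases j with _ | j
  · exact zero_le
  · exact le_iSup (fun j => bluesBefore (S 0) (backward j fun i => S (i + 1))) j

/-! ### Paths driven by draws -/

/-- `X` is a path on `ℤ` started at `0` whose `k`-th departure from `x` follows `s x k`. -/
structure IsDriven (s : ℤ → ℕ → Bool) (X : ℕ → ℤ) : Prop where
  start : X 0 = 0
  step : ∀ n, X (n + 1) = if s (X n) (visits X (X n) n) = true then X n + 1 else X n - 1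

lemma visits_zero (X : ℕ → ℤ) (x : ℤ) : visits X x 0 = 0 := rfl

lemma visits_succ (X : ℕ → ℤ) (x : ℤ) (n : ℕ) :
    visits X x (n + 1) = visits X x n + if X n = x then 1 else 0 := by
  unfold visits
  rw [Finset.range_add_one, Finset.filter_insert]
  split_ifs with h
  · rw [Finset.card_insert_of_notMem (by simp)]
  · simp

lemma visits_mono (X : ℕ → ℤ) (x : ℤ) : Monotone (visits X x) :=
  monotone_nat_of_le_succ fun n => by rw [visits_succ]; omega

lemma visits_eq_zero {X : ℕ → ℤ} {x : ℤ} {n : ℕ} (h : ∀ m < n, X m ≠ x) : visits X x n = 0 := by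
  unfold visits
  rw [Finset.card_eq_zero, Finset.filter_eq_empty_iff]
  intro m hm
  exact h m (Finset.mem_range.1 hm)

lemma visits_eq_of_le {X : ℕ → ℤ} {x : ℤ} {K : ℕ} (h : ∀ m, K ≤ m → X m ≠ x) (n : ℕ) :
    visits X x n ≤ visits X x K := by
  rcases le_total n K with hn | hn
  · exact visits_mono X x hn
  · induction n, hn using Nat.le_induction with
    | base => exact le_rfl
    | succ n hn ih => rw [visits_succ, if_neg (h n hn)]; omega

/-- If `x` is visited infinitely often then each `k` is the rank of some visit. -/
lemma exists_visits_eq {X : ℕ → ℤ} {x : ℤ} (h : ∃ᶠ n in atTop, X n = x) (k : ℕ) :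
    ∃ n, X n = x ∧ visits X x n = k := by
  have key : ∀ n, ∃ m, n ≤ m ∧ X m = x ∧ visits X x m = visits X x n := by
    intro n
    have hex := (frequently_atTop.1 h n)
    classical
    refine ⟨Nat.find hex, (Nat.find_spec hex).1, (Nat.find_spec hex).2, ?_⟩
    have : ∀ m, n ≤ m → m ≤ Nat.find hex → visits X x m = visits X x n := by
      intro m hm
      induction m, hm using Nat.le_induction with
      | base => intro _; rfl
      | succ m hm ih =>
        intro hle
        have := Nat.find_min hex (m := m) (by omega)
        rw [visits_succ, ih (by omega), if_neg fun hs => this ⟨hm, hs⟩]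
        rfl
    exact this _ (Nat.find_spec hex).1 le_rfl
  induction k with
  | zero =>
    obtain ⟨m, -, h1, h2⟩ := key 0
    exact ⟨m, h1, h2⟩
  | succ k ih =>
    obtain ⟨n, h1, h2⟩ := ih
    obtain ⟨m, -, h3, h4⟩ := key (n + 1)
    exact ⟨m, h3, by rw [h4, visits_succ, h2, if_pos h1]⟩

namespace IsDriven

variable {s : ℤ → ℕ → Bool} {X : ℕ → ℤ}

lemma step_cases (h : IsDriven s X) (n : ℕ) :
    (s (X n) (visits X (X n) n) = true ∧ X (n + 1) = X n + 1) ∨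
    (s (X n) (visits X (X n) n) = false ∧ X (n + 1) = X n - 1) := by
  rw [h.step n]
  cases s (X n) (visits X (X n) n) <;> simp

/-- Crossings of the edge between `x` and `x + 1` alternate in direction, and the start `0 ≤ x` lies
on its left side. -/
lemma crossings (h : IsDriven s X) {x : ℤ} (hx : 0 ≤ x) (n : ℕ) :
    reds (visits X x n) (s x) =
      blues (visits X (x + 1) n) (s (x + 1)) + if x < X n then 1 else 0 := by
  induction n with
  | zero => simp [visits_zero, reds_zero, blues_zero, h.start, hx.not_gt]
  | succ n ih =>
    rw [visits_succ, visits_succ]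
    by_cases h1 : X n = x
    · subst h1
      have hne : ¬ X n = X n + 1 := by omega
      rw [if_pos rfl, if_neg hne, reds_succ, ih]
      rcases h.step_cases n with ⟨hs, hX⟩ | ⟨hs, hX⟩ <;> rw [hs, hX] <;> simp
    · rw [if_neg h1]
      by_cases h2 : X n = x + 1
      · rw [if_pos h2, blues_succ, add_zero, ih, ← h2]
        rcases h.step_cases n with ⟨hs, hX⟩ | ⟨hs, hX⟩ <;> rw [hs, hX] <;> simp <;> split_ifs <;> omega
      · rw [if_neg h2, add_zero, add_zero, ih]
        rcases h.step_cases n with ⟨hs, hX⟩ | ⟨hs, hX⟩ <;> rw [hX] <;> congr 1 <;>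
          split_ifs <;> omega

lemma last_departure (h : IsDriven s X) {x : ℤ} (hx : 0 ≤ x) {n : ℕ} (hn : x < X n) :
    ∃ k, visits X x n = k + 1 ∧ s x k = true := by
  induction n with
  | zero => rw [h.start] at hn; omega
  | succ n ih =>
    rw [visits_succ]
    rcases lt_trichotomy (X n) x with h1 | h1 | h1
    · rcases h.step_cases n with ⟨hs, hX⟩ | ⟨hs, hX⟩ <;> omega
    · refine ⟨visits X x n, by rw [if_pos h1], ?_⟩
      rcases h.step_cases n with ⟨hs, hX⟩ | ⟨hs, hX⟩
      · rwa [h1] at hs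
      · omega
    · obtain ⟨k, hk, hred⟩ := ih h1
      exact ⟨k, by rw [if_neg (by omega), hk], hred⟩

/-- Left jumps before a first passage are given by the backward recursion. -/
lemma blues_visits_eq_backward (h : IsDriven s X) {n : ℕ} (hn : ∀ m < n, X m ≠ X n) (j : ℕ)
    {x : ℤ} (hx : 0 ≤ x) (hj : x + j = X n) :
    (blues (visits X x n) (s x) : ℕ∞) = backward j (fun i => s (x + i)) := by
  induction j generalizing x with
  | zero =>
    have : x = X n := by simpa using hj
    rw [this, visits_eq_zero hn]; rfl
  | succ j ih =>
    push_cast at hj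
    have ih' := ih (x := x + 1) (by omega) (by omega)
    have hlt : x < X n := by omega
    obtain ⟨k, hk, hs⟩ := h.last_departure hx hlt
    have hc := h.crossings hx n
    rw [hk, if_pos hlt, reds_succ, if_pos hs] at hc
    have hc' : reds k (s x) = blues (visits X (x + 1) n) (s (x + 1)) := by omega
    have hfun : (fun i : ℕ => s (x + ((i + 1 : ℕ) : ℤ))) = fun i : ℕ => s (x + 1 + (i : ℤ)) := by
      funext i; congr 1; push_cast; ring
    rw [backward, hfun, ← ih', ← hc']
    simp only [Nat.cast_zero, add_zero]
    rw [bluesBefore_reds hs, hk, blues_succ, hs]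
    simp

lemma exists_first_passage (h : IsDriven s X) {N : ℕ} (hN : ∃ n, (N : ℤ) ≤ X n) :
    ∃ n, X n = N ∧ ∀ m < n, X m < X n := by
  classical
  have h1 := Nat.find_spec hN
  have h2 := fun m => Nat.find_min hN (m := m)
  generalize Nat.find hN = n at h1 h2
  have hXn : X n = N := by
    rcases n with _ | n
    · rw [h.start] at h1 ⊢; omega
    · have := h2 n (by omega)
      rcases h.step_cases n with ⟨hs, hX⟩ | ⟨hs, hX⟩ <;> omega
  exact ⟨n, hXn, fun m hm => by have := h2 m hm; omega⟩

lemma le_time (h : IsDriven s X) (n : ℕ) : X n ≤ n := by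
  induction n with
  | zero => simp [h.start]
  | succ n ih =>
    push_cast
    rcases h.step_cases n with ⟨hs, hX⟩ | ⟨hs, hX⟩ <;> omega

/-- Every term of the recursion counts left jumps from `1`, so it is bounded by the finite total
number of visits to `1`. -/
lemma backwardLim_lt_top (h : IsDriven s X) (hX : Tendsto X atTop atTop) :
    backwardLim (fun i => s (1 + i)) < ⊤ := by
  obtain ⟨K, hK⟩ := eventually_atTop.1 (hX.eventually_gt_atTop 1)
  refine lt_of_le_of_lt (iSup_le fun j => ?_) (ENat.natCast_lt_top (visits X 1 K))
  obtain ⟨n, hn, hlt⟩ := h.exists_first_passage (N := 1 + j)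
    (hX.eventually_ge_atTop _).exists
  rw [← h.blues_visits_eq_backward (fun m hm => (hlt m hm).ne) j zero_le_one
    (by rw [hn]; push_cast; rfl)]
  have h1 := reds_add_blues (visits X 1 n) (s 1)
  have h2 := visits_eq_of_le (X := X) (x := 1) (fun m hm => (hK m hm).ne') n
  exact_mod_cast (by omega)

lemma backwardLim_eq_top (h : IsDriven s X) (hs : IsMixed (s 1)) (hX : IsRecurrentPath X) :
    backwardLim (fun i => s (1 + i)) = ⊤ := by
  rw [ENat.eq_top_iff_forall_ge]
  intro K
  obtain ⟨k, hk⟩ := hs.exists_le_blues K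
  obtain ⟨m, -, hm⟩ := exists_visits_eq (hX 1) k
  -- The target `1 + m` cannot be reached before time `1 + m`, so its first passage comes after the
  -- first `k` departures from `1`, which already include `K` left jumps.
  obtain ⟨n', hn'⟩ := (hX ((1 + m : ℕ) : ℤ)).exists
  obtain ⟨n, hn, hlt⟩ := h.exists_first_passage ⟨n', hn'.ge⟩
  refine le_trans ?_ (le_iSup _ m)
  rw [← h.blues_visits_eq_backward (fun m hm => (hlt m hm).ne) m zero_le_one
    (by rw [hn]; push_cast; rfl)]
  have h1 := h.le_time n
  have h2 := blues_mono (s 1) (visits_mono X 1 (show m ≤ n by omega))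
  simp only [hm] at h2
  exact_mod_cast hk.trans h2

/-- A site visited infinitely often uses all its draws, hence both colours beyond any time. -/
lemma frequently_succ (h : IsDriven s X) {x : ℤ} (hs : IsMixed (s x))
    (hx : ∃ᶠ n in atTop, X n = x) (c : Bool) :
    ∃ᶠ n in atTop, X n = x + if c = true then 1 else -1 := by
  rw [frequently_atTop]
  intro M
  obtain ⟨k, hk, hc⟩ := hs c (visits X x M)
  obtain ⟨n, hn, hv⟩ := exists_visits_eq hx k
  refine ⟨n + 1, ?_, ?_⟩
  · by_contra hlt
    have := visits_mono X x (show n + 1 ≤ M by omega)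
    rw [visits_succ, if_pos hn] at this
    omega
  · rcases h.step_cases n with ⟨h1, h2⟩ | ⟨h1, h2⟩ <;> rw [hn, hv, hc] at h1 <;>
      rw [h2, h1, hn] <;> simp <;> rfl

lemma recurrent_of_frequently (h : IsDriven s X) (hs : ∀ x, IsMixed (s x)) {x : ℤ}
    (hx : ∃ᶠ n in atTop, X n = x) : IsRecurrentPath X := by
  have hup : ∀ k : ℕ, ∃ᶠ n in atTop, X n = x + k := by
    intro k
    induction k with
    | zero => simpa using hx
    | succ k ih => simpa [add_assoc] using h.frequently_succ (hs _) ih true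
  have hdown : ∀ k : ℕ, ∃ᶠ n in atTop, X n = x - k := by
    intro k
    induction k with
    | zero => simpa using hx
    | succ k ih =>
      have := h.frequently_succ (hs _) ih false
      push_cast
      simpa [← sub_eq_add_neg, sub_sub] using this
  intro y
  rcases le_total x y with hxy | hxy
  · have := hup (y - x).toNat
    rwa [Int.toNat_of_nonneg (by omega), add_sub_cancel] at this
  · have := hdown (x - y).toNat
    rwa [Int.toNat_of_nonneg (by omega), sub_sub_cancel] at this

/-- If no site is visited infinitely often, unit steps keep the path on one side of `0` after its
last visit there, and it leaves every bounded interval. -/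
lemma recurrent_or_tendsto (h : IsDriven s X) (hs : ∀ x, IsMixed (s x)) :
    IsRecurrentPath X ∨ Tendsto X atTop atTop ∨ Tendsto X atTop atBot := by
  by_cases hx : ∃ x, ∃ᶠ n in atTop, X n = x
  · exact Or.inl (h.recurrent_of_frequently hs hx.choose_spec)
  right
  push Not at hx
  have hx' : ∀ x, ∀ᶠ n in atTop, X n ≠ x := hx
  have hfin : ∀ B : ℤ, ∀ᶠ n in atTop, ∀ x ∈ Set.Icc (-B) B, X n ≠ x := fun B =>
    (Filter.eventually_all_finite (Set.finite_Icc (-B) B)).2 fun x _ => hx' x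
  obtain ⟨n₀, hn₀⟩ := eventually_atTop.1 (hx' 0)
  rcases (hn₀ n₀ le_rfl).lt_or_gt with hneg | hpos
  · right
    have hall : ∀ n, n₀ ≤ n → X n < 0 := by
      intro n hn
      induction n, hn using Nat.le_induction with
      | base => exact hneg
      | succ n hn ih =>
        have := hn₀ (n + 1) (by omega)
        rcases h.step_cases n with ⟨h1, h2⟩ | ⟨h1, h2⟩ <;> omega
    refine tendsto_atBot.2 fun b => ?_
    filter_upwards [hfin (-b), eventually_ge_atTop n₀] with n hn hn'
    by_contra hlt
    have := hall n hn'
    exact hn (X n) ⟨by omega, by omega⟩ rfl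
  · left
    have hall : ∀ n, n₀ ≤ n → 0 < X n := by
      intro n hn
      induction n, hn using Nat.le_induction with
      | base => exact hpos
      | succ n hn ih =>
        have := hn₀ (n + 1) (by omega)
        rcases h.step_cases n with ⟨h1, h2⟩ | ⟨h1, h2⟩ <;> omega
    refine tendsto_atTop.2 fun b => ?_
    filter_upwards [hfin b, eventually_ge_atTop n₀] with n hn hn'
    by_contra hlt
    have := hall n hn'
    exact hn (X n) ⟨by omega, by omega⟩ rfl

lemma visits_neg (X : ℕ → ℤ) (x : ℤ) (n : ℕ) : visits (fun m => -X m) x n = visits X (-x) n := by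
  unfold visits
  congr 1
  ext k
  simp only [Finset.mem_filter, neg_eq_iff_eq_neg]

lemma neg (h : IsDriven s X) : IsDriven (fun x k => !s (-x) k) (fun n => -X n) where
  start := by simp [h.start]
  step n := by
    rw [visits_neg, neg_neg]
    rcases h.step_cases n with ⟨h1, h2⟩ | ⟨h1, h2⟩ <;> rw [h1, h2] <;> simp <;> ring

end IsDriven

/-! ### Laws of sequences of draws -/

/-- The sequences that start like `b` up to time `n`. -/
def prefixSet (b : ℕ → Bool) (n : ℕ) : Set (ℕ → Bool) := {s | ∀ k < n, s k = b k}

/-- Extension of a finite sequence of draws by blue draws. -/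
def extendDraws {n : ℕ} (b : Fin n → Bool) (k : ℕ) : Bool := if h : k < n then b ⟨k, h⟩ else false

/-- Under `ν`, given the first `n` draws `b`, the next draw is red with probability `q n b`; the
conditional probabilities are bounded away from `0` and `1`. -/
structure IsDrawLaw (ν : Measure (ℕ → Bool)) (q : ℕ → (ℕ → Bool) → ℝ) : Prop where
  dependsOn : ∀ n, DependsOn (q n) (Set.Iio n)
  elliptic : ∃ c > 0, ∀ n b, q n b ∈ Set.Icc c (1 - c)
  draw : ∀ n b, ν (prefixSet b n ∩ {s | s n = true}) = ν (prefixSet b n) * ENNReal.ofReal (q n b)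

lemma extendDraws_restrict {n : ℕ} (s : ℕ → Bool) {k : ℕ} (hk : k < n) :
    extendDraws (fun i : Fin n => s i) k = s k := by simp [extendDraws, hk]

/-- Such a function factors through the finite type `Fin n → Bool`; the values supplied by
`extendDraws` from `n` on are irrelevant. -/
lemma DependsOn.measurable_prefix {β : Type*} [MeasurableSpace β] {n : ℕ}
    {g : (ℕ → Bool) → β} (hg : DependsOn g (Set.Iio n)) : Measurable g := by
  have : g = (fun b : Fin n → Bool => g (extendDraws b)) ∘ fun s i => s i := by
    funext s
    exact hg fun k hk => (extendDraws_restrict s hk).symm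
  rw [this]
  exact (measurable_of_countable _).comp (by fun_prop)

lemma dependsOn_reds (n : ℕ) : DependsOn (reds n) (Set.Iio n) := fun _ _ h => reds_congr h
lemma dependsOn_blues (n : ℕ) : DependsOn (blues n) (Set.Iio n) := fun _ _ h => blues_congr h

lemma measurable_reds (n : ℕ) : Measurable (reds n) := (dependsOn_reds n).measurable_prefix
lemma measurable_blues (n : ℕ) : Measurable (blues n) := (dependsOn_blues n).measurable_prefix

lemma measurableSet_prefixSet (b : ℕ → Bool) (n : ℕ) : MeasurableSet (prefixSet b n) := by
  have : DependsOn (fun s => s ∈ prefixSet b n) (Set.Iio n) := by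
    intro s t h
    simp only [prefixSet, mem_ofPred_eq, eq_iff_iff]
    exact forall₂_congr fun k hk => by rw [h k hk]
  exact measurableSet_setOfPred.2 this.measurable_prefix

lemma measurableSet_draw (n : ℕ) (c : Bool) : MeasurableSet {s : ℕ → Bool | s n = c} :=
  measurableSet_eq_fun (measurable_pi_apply n) measurable_const

lemma mem_prefixSet_extend {n : ℕ} {b : Fin n → Bool} {s : ℕ → Bool} :
    s ∈ prefixSet (extendDraws b) n ↔ (fun i : Fin n => s i) = b := by
  constructor
  · intro h
    funext i
    have := h i i.2
    simpa [extendDraws] using this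
  · rintro rfl k hk
    exact (extendDraws_restrict s hk).symm

lemma prefixSet_succ (b : ℕ → Bool) (n : ℕ) :
    prefixSet b (n + 1) = prefixSet b n ∩ {s | s n = b n} := by
  ext s
  simp only [prefixSet, mem_ofPred_eq, mem_inter_iff]
  constructor
  · exact fun h => ⟨fun k hk => h k (by omega), h n (by omega)⟩
  · rintro ⟨h1, h2⟩ k hk
    rcases Nat.lt_succ_iff_lt_or_eq.1 hk with h | rfl
    · exact h1 k h
    · exact h2

lemma lintegral_eq_sum_prefix (ν : Measure (ℕ → Bool)) (n : ℕ) (F : (ℕ → Bool) → ENNReal) :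
    ∫⁻ s, F s ∂ν = ∑ b : Fin n → Bool, ∫⁻ s in prefixSet (extendDraws b) n, F s ∂ν := by
  rw [← tsum_fintype (L := .unconditional _),
    ← lintegral_iUnion (fun b => measurableSet_prefixSet _ n), ← setLIntegral_univ]
  · congr 2
    symm
    rw [Set.eq_univ_iff_forall]
    exact fun s => mem_iUnion.2 ⟨fun i => s i, mem_prefixSet_extend.2 rfl⟩
  · intro b b' hbb
    rw [Function.onFun, Set.disjoint_left]
    intro s h1 h2
    exact hbb ((mem_prefixSet_extend.1 h1).symm.trans (mem_prefixSet_extend.1 h2))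

lemma measurable_bluesBefore : Measurable fun p : (ℕ → Bool) × ℕ∞ => bluesBefore p.1 p.2 := by
  have : BorelSpace ℕ∞ := ⟨borel_eq_top_of_countable.symm⟩
  refine measurable_from_prod_countable_left fun y => ?_
  refine Measurable.iSup fun n => ?_
  refine Measurable.ite ?_ ?_ measurable_const
  · exact (measurable_reds n) (MeasurableSet.of_discrete (s := {r : ℕ | (r : ℕ∞) ≤ y}))
  · exact (measurable_of_countable (fun r : ℕ => (r : ℕ∞))).comp (measurable_blues n)

lemma measurable_backward (j : ℕ) : Measurable (backward j) := by
  induction j with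
  | zero => exact measurable_const
  | succ j ih =>
    have hshift : Measurable fun (S : ℕ → ℕ → Bool) (i : ℕ) => S (i + 1) :=
      measurable_pi_lambda _ fun i => measurable_pi_apply (i + 1)
    have hpair : Measurable fun S : ℕ → ℕ → Bool => (S 0, backward j fun i => S (i + 1)) :=
      (measurable_pi_apply 0).prodMk (ih.comp hshift)
    exact measurable_bluesBefore.comp hpair

lemma measurable_backwardLim : Measurable backwardLim := by
  have : BorelSpace ℕ∞ := ⟨borel_eq_top_of_countable.symm⟩
  exact Measurable.iSup measurable_backward

lemma measurable_flip : Measurable fun (s : ℕ → Bool) (k : ℕ) => !s k :=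
  measurable_pi_lambda _ fun k => (measurable_of_countable Bool.not).comp (measurable_pi_apply k)

/-! ### Drift balance and geometric weights -/

/-- The expected drift carried by the draws up to the `(y + 1)`-th red one. -/
noncomputable def driftUpTo (ν : Measure (ℕ → Bool)) (q : ℕ → (ℕ → Bool) → ℝ) (y : ℕ∞) : ENNReal :=
  ∫⁻ s, ∑' k, (if (reds k s : ℕ∞) ≤ y then ENNReal.ofReal (2 * q k s - 1) else 0) ∂ν

/-- The function `y ↦ (m / (m + 1)) ^ y`, vanishing at infinity. -/
noncomputable def geomWeight (m : ℕ) (y : ℕ∞) : ENNReal :=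
  if y = ⊤ then 0 else ENNReal.ofReal (((m : ℝ) / (m + 1)) ^ y.toNat)

lemma geomWeight_top (m : ℕ) : geomWeight m ⊤ = 0 := if_pos rfl

lemma geomWeight_coe (m y : ℕ) : geomWeight m y = ENNReal.ofReal (((m : ℝ) / (m + 1)) ^ y) := by
  simp [geomWeight]

lemma ratio_nonneg (m : ℕ) : (0 : ℝ) ≤ (m : ℝ) / (m + 1) := by positivity

lemma ratio_le_one (m : ℕ) : (m : ℝ) / (m + 1) ≤ 1 := by
  rw [div_le_one (by positivity)]; linarith

lemma geomWeight_le_one (m : ℕ) (y : ℕ∞) : geomWeight m y ≤ 1 := by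
  unfold geomWeight
  split_ifs
  · exact zero_le
  · rw [← ENNReal.ofReal_one]
    exact ENNReal.ofReal_le_ofReal (pow_le_one₀ (ratio_nonneg m) (ratio_le_one m))

lemma geomWeight_antitone (m : ℕ) : Antitone (geomWeight m) := by
  intro y z hyz
  by_cases hz : z = ⊤
  · rw [hz, geomWeight_top]; exact zero_le
  lift z to ℕ using hz
  lift y to ℕ using (lt_of_le_of_lt hyz (ENat.natCast_lt_top z)).ne
  rw [geomWeight_coe, geomWeight_coe]
  exact ENNReal.ofReal_le_ofReal
    (pow_le_pow_of_le_one (ratio_nonneg m) (ratio_le_one m) (by exact_mod_cast hyz))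

lemma geomWeight_add_one (m : ℕ) (y : ℕ∞) :
    geomWeight m (y + 1) = ENNReal.ofReal ((m : ℝ) / (m + 1)) * geomWeight m y := by
  by_cases hy : y = ⊤
  · simp [hy, geomWeight_top]
  lift y to ℕ using hy
  rw [show ((y : ℕ∞) + 1) = ((y + 1 : ℕ) : ℕ∞) by push_cast; rfl, geomWeight_coe, geomWeight_coe,
    pow_succ', ENNReal.ofReal_mul (ratio_nonneg m)]

lemma reds_le_iff {s : ℕ → Bool} {n : ℕ} (h : s n = true) (k : ℕ) :
    (reds k s : ℕ∞) ≤ (reds n s : ℕ) ↔ k < n + 1 := by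
  rw [Nat.cast_le]
  constructor
  · intro hk
    by_contra hlt
    have h1 := reds_mono s (show n + 1 ≤ k by omega)
    simp only [reds_succ, if_pos h] at h1
    omega
  · exact fun hk => reds_mono s (show k ≤ n by omega)

lemma tsum_draws_upTo {s : ℕ → Bool} {n : ℕ} (h : s n = true) (c : Bool) :
    ∑' k, (if (reds k s : ℕ∞) ≤ (reds n s : ℕ) then (if s k = c then 1 else 0) else 0 : ENNReal) =
      (Nat.count (fun k => s k = c) (n + 1) : ℕ) := by
  rw [tsum_eq_sum (s := Finset.range (n + 1))]
  · rw [Nat.count_eq_card_filter_range, Finset.card_filter]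
    push_cast
    refine Finset.sum_congr rfl fun k hk => ?_
    rw [if_pos ((reds_le_iff h k).2 (Finset.mem_range.1 hk))]
  · intro k hk
    rw [if_neg fun h' => hk (Finset.mem_range.2 ((reds_le_iff h k).1 h'))]

namespace IsDrawLaw

variable {ν : Measure (ℕ → Bool)} {q : ℕ → (ℕ → Bool) → ℝ}

lemma nonneg (h : IsDrawLaw ν q) (n : ℕ) (b : ℕ → Bool) : 0 ≤ q n b := by
  obtain ⟨c, hc, hq⟩ := h.elliptic
  exact hc.le.trans (hq n b).1

lemma le_one (h : IsDrawLaw ν q) (n : ℕ) (b : ℕ → Bool) : q n b ≤ 1 := by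
  obtain ⟨c, hc, hq⟩ := h.elliptic
  have := (hq n b).2
  linarith

lemma measurable (h : IsDrawLaw ν q) (n : ℕ) : Measurable (q n) := (h.dependsOn n).measurable_prefix

lemma draw_blue [IsProbabilityMeasure ν] (h : IsDrawLaw ν q) (n : ℕ) (b : ℕ → Bool) :
    ν (prefixSet b n ∩ {s | s n = false}) = ν (prefixSet b n) * ENNReal.ofReal (1 - q n b) := by
  have h1 := measure_inter_add_sdiff (μ := ν) (prefixSet b n) (measurableSet_draw n true)
  have h2 : prefixSet b n \ {s | s n = true} = prefixSet b n ∩ {s | s n = false} := by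
    ext s; simp
  rw [h2, h.draw] at h1
  have h3 : ν (prefixSet b n) * ENNReal.ofReal (q n b) ≠ ⊤ :=
    ENNReal.mul_ne_top (measure_ne_top _ _) ENNReal.ofReal_ne_top
  refine (ENNReal.add_right_inj h3).1 ?_
  rw [h1, ← mul_add, ← ENNReal.ofReal_add (h.nonneg n b) (by linarith [h.le_one n b])]
  simp

/-- On each cylinder of length `n` both `q n` and `g c` are constant, so conditioning on the past
reduces to a finite sum. -/
lemma lintegral_draw [IsProbabilityMeasure ν] (h : IsDrawLaw ν q) (n : ℕ)
    {g : Bool → (ℕ → Bool) → ENNReal} (hg : ∀ c, DependsOn (g c) (Set.Iio n)) :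
    ∫⁻ s, g (s n) s ∂ν =
      ∫⁻ s, (ENNReal.ofReal (q n s) * g true s + ENNReal.ofReal (1 - q n s) * g false s) ∂ν := by
  rw [lintegral_eq_sum_prefix ν n, lintegral_eq_sum_prefix ν n]
  refine Finset.sum_congr rfl fun b' _ => ?_
  generalize extendDraws b' = b
  have hA := measurableSet_prefixSet b n
  rw [← lintegral_inter_add_sdiff (μ := ν) _ (prefixSet b n) (measurableSet_draw n true)]
  have h2 : prefixSet b n \ {s | s n = true} = prefixSet b n ∩ {s | s n = false} := by
    ext s; simp
  rw [h2]
  have key : ∀ c, ∫⁻ s in prefixSet b n ∩ {s | s n = c}, g (s n) s ∂ν =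
      g c b * ν (prefixSet b n ∩ {s | s n = c}) := by
    intro c
    rw [← setLIntegral_const]
    refine setLIntegral_congr_fun (hA.inter (measurableSet_draw n c)) ?_
    rintro s ⟨h1, h3⟩
    simp only [mem_ofPred_eq] at h3
    simp only [h3]
    exact hg c fun k hk => h1 k hk
  rw [key, key, h.draw, h.draw_blue]
  have : ∫⁻ s in prefixSet b n, (ENNReal.ofReal (q n s) * g true s +
      ENNReal.ofReal (1 - q n s) * g false s) ∂ν =
      (ENNReal.ofReal (q n b) * g true b + ENNReal.ofReal (1 - q n b) * g false b) *
        ν (prefixSet b n) := by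
    rw [← setLIntegral_const]
    refine setLIntegral_congr_fun hA fun s hs => ?_
    rw [h.dependsOn n (x := s) (y := b) fun k hk => hs k hk,
      hg true (x := s) (y := b) fun k hk => hs k hk, hg false (x := s) (y := b) fun k hk => hs k hk]
  rw [this]
  ring

lemma flip [IsProbabilityMeasure ν] (h : IsDrawLaw ν q) :
    IsDrawLaw (ν.map fun s k => !s k) (fun n s => 1 - q n fun k => !s k) where
  dependsOn n s t hst := by
    change 1 - q n (fun k => !s k) = 1 - q n (fun k => !t k)
    rw [h.dependsOn n (x := fun k => !s k) (y := fun k => !t k) fun k hk => by simp [hst k hk]]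
  elliptic := by
    obtain ⟨c, hc, hq⟩ := h.elliptic
    refine ⟨c, hc, fun n b => ?_⟩
    have := hq n fun k => !b k
    exact ⟨by linarith [this.2], by linarith [this.1]⟩
  draw n b := by
    have hpre : (fun (s : ℕ → Bool) (k : ℕ) => !s k) ⁻¹' prefixSet b n =
        prefixSet (fun k => !b k) n := by
      ext s
      simp only [prefixSet, mem_preimage, mem_ofPred_eq]
      exact forall₂_congr fun k _ => by cases s k <;> cases b k <;> simp
    rw [Measure.map_apply measurable_flip ((measurableSet_prefixSet b n).inter (measurableSet_draw n true)),
      Measure.map_apply measurable_flip (measurableSet_prefixSet b n), preimage_inter, hpre,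
      ← h.draw_blue]
    congr 2
    ext s
    simp

/-- By ellipticity each further blue draw costs a factor `1 - c`, so an endless blue run has
probability zero. -/
lemma ae_exists_red [IsProbabilityMeasure ν] (h : IsDrawLaw ν q) :
    ∀ᵐ s ∂ν, ∀ n, ∃ k, n ≤ k ∧ s k = true := by
  rw [ae_all_iff]
  intro n
  obtain ⟨c, hc, hq⟩ := h.elliptic
  have key : ∀ j, ν {s | ∀ i < j, s (n + i) = false} ≤ ENNReal.ofReal (1 - c) ^ j := by
    intro j
    induction j with
    | zero => simp
    | succ j ih =>
      set A : Set (ℕ → Bool) := {s | ∀ i < j, s (n + i) = false} with hA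
      have hdep : DependsOn (fun s => s ∈ A) (Set.Iio (n + j)) := by
        intro s t hst
        simp only [hA, mem_ofPred_eq, eq_iff_iff]
        exact forall₂_congr fun i hi => by rw [hst (n + i) (by simp [hi])]
      have hmA : MeasurableSet A := measurableSet_setOfPred.2 hdep.measurable_prefix
      have hg : ∀ a : Bool, DependsOn
          (fun s : ℕ → Bool => if a = false then A.indicator (1 : (ℕ → Bool) → ENNReal) s else 0)
          (Set.Iio (n + j)) := by
        intro a s t hst
        have hst' := hdep hst
        simp only [eq_iff_iff] at hst'
        simp only [Set.indicator_apply, hst']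
        rfl
      have hset : ν {s | ∀ i < j + 1, s (n + i) = false} =
          ∫⁻ s, (if s (n + j) = false then A.indicator (1 : (ℕ → Bool) → ENNReal) s else 0) ∂ν := by
        rw [← lintegral_indicator_one]
        · refine lintegral_congr fun s => ?_
          by_cases h1 : s (n + j) = false
          · simp only [h1, if_true, Set.indicator_apply]
            congr 1
            simp only [hA, mem_ofPred_eq, eq_iff_iff]
            refine ⟨fun h2 i hi => h2 i (by omega), fun h2 i hi => ?_⟩
            rcases Nat.lt_succ_iff_lt_or_eq.1 hi with h3 | rfl
            · exact h2 i h3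
            · exact h1
          · rw [if_neg h1, Set.indicator_of_notMem]
            exact fun h2 => h1 (h2 j (by omega))
        · simp only [ofPred_forall]
          exact MeasurableSet.iInter fun i => MeasurableSet.iInter fun _ => measurableSet_draw _ _
      rw [hset, h.lintegral_draw (n + j) hg, pow_succ']
      calc _ ≤ ∫⁻ s, ENNReal.ofReal (1 - c) * A.indicator 1 s ∂ν := by
            refine lintegral_mono fun s => ?_
            simp only [Bool.true_eq_false, if_false, mul_zero, if_true, zero_add]
            gcongr
            exact (hq _ _).1
        _ ≤ _ := by
            rw [lintegral_const_mul _ (measurable_one.indicator hmA), lintegral_indicator_one hmA]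
            gcongr
  have hzero : ν {s | ∀ i, s (n + i) = false} = 0 := by
    refine le_antisymm (ge_of_tendsto' (ENNReal.tendsto_pow_atTop_nhds_zero_of_lt_one
      (r := ENNReal.ofReal (1 - c)) ?_) fun j => (measure_mono ?_).trans (key j)) zero_le
    · rw [ENNReal.ofReal_lt_one]; linarith
    · exact fun s hs i _ => hs i
  rw [ae_iff]
  refine measure_mono_null ?_ hzero
  intro s hs i
  simp only [mem_ofPred_eq, not_exists, not_and, Bool.not_eq_true] at hs
  exact hs (n + i) (by omega)

lemma ae_isMixed [IsProbabilityMeasure ν] (h : IsDrawLaw ν q) : ∀ᵐ s ∂ν, IsMixed s := by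
  have : IsProbabilityMeasure (ν.map fun s k => !s k) := Measure.isProbabilityMeasure_map measurable_flip.aemeasurable
  have h2 := ae_of_ae_map measurable_flip.aemeasurable h.flip.ae_exists_red
  filter_upwards [h.ae_exists_red, h2] with s hs1 hs2 c n
  cases c
  · simpa using hs2 n
  · exact hs1 n

/-- The law of a sequence of draws is determined by the conditional probabilities. -/
lemma unique {ν' : Measure (ℕ → Bool)} [IsProbabilityMeasure ν] [IsProbabilityMeasure ν']
    (h : IsDrawLaw ν q) (h' : IsDrawLaw ν' q) : ν = ν' := by
  have hpre : ∀ b n, ν (prefixSet b n) = ν' (prefixSet b n) := by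
    intro b n
    induction n with
    | zero => simp [prefixSet]
    | succ n ih =>
      rw [prefixSet_succ]
      cases b n
      · rw [h.draw_blue, h'.draw_blue, ih]
      · rw [h.draw, h'.draw, ih]
  refine ext_of_generate_finite {A | ∃ b n, A = prefixSet b n} ?_ ?_ ?_ (by simp)
  · refine le_antisymm ?_ (MeasurableSpace.generateFrom_le ?_)
    · refine iSup_le fun n => ?_
      rintro _ ⟨C, -, rfl⟩
      have : (fun s : ℕ → Bool => s n) ⁻¹' C =
          ⋃ b : {b : Fin (n + 1) → Bool // b ⟨n, by omega⟩ ∈ C},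
            prefixSet (extendDraws b.1) (n + 1) := by
        ext s
        simp only [mem_preimage, mem_iUnion, mem_prefixSet_extend]
        constructor
        · exact fun hs => ⟨⟨fun i => s i, hs⟩, rfl⟩
        · rintro ⟨⟨b, hb⟩, rfl⟩
          exact hb
      rw [this]
      exact MeasurableSet.iUnion fun b => MeasurableSpace.measurableSet_generateFrom ⟨_, _, rfl⟩
    · rintro _ ⟨b, n, rfl⟩
      exact measurableSet_prefixSet b n
  -- Two cylinders are nested or disjoint, so they form a π-system.
  · have aux : ∀ b n b' m, n ≤ m → (prefixSet b n ∩ prefixSet b' m).Nonempty →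
        prefixSet b n ∩ prefixSet b' m = prefixSet b' m := by
      rintro b n b' m hnm ⟨t, ht1, ht2⟩
      refine inter_eq_right.2 fun s hs k hk => ?_
      rw [hs k (by omega), ← ht1 k hk, ht2 k (by omega)]
    rintro _ ⟨b, n, rfl⟩ _ ⟨b', m, rfl⟩ hne
    rcases le_total n m with hnm | hnm
    · exact ⟨b', m, aux b n b' m hnm hne⟩
    · rw [inter_comm] at hne ⊢
      exact ⟨b, n, aux b' m b n hnm hne⟩
  · rintro _ ⟨b, n, rfl⟩
    exact hpre b n

lemma prefixSet_pos [IsProbabilityMeasure ν] (h : IsDrawLaw ν q) (b : ℕ → Bool) (n : ℕ) :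
    0 < ν (prefixSet b n) := by
  obtain ⟨c, hc, hq⟩ := h.elliptic
  induction n with
  | zero => simp [prefixSet]
  | succ n ih =>
    have := hq n b
    rw [prefixSet_succ]
    cases b n
    · rw [h.draw_blue]
      exact ENNReal.mul_pos ih.ne' (ENNReal.ofReal_pos.2 (by linarith [this.2])).ne'
    · rw [h.draw]
      exact ENNReal.mul_pos ih.ne' (ENNReal.ofReal_pos.2 (by linarith [this.1])).ne'

lemma measurable_drift_term (h : IsDrawLaw ν q) (y : ℕ∞) (k : ℕ) : Measurable fun s =>
    (if (reds k s : ℕ∞) ≤ y then ENNReal.ofReal (2 * q k s - 1) else 0) := by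
  refine Measurable.ite ?_ ((h.measurable k).const_mul 2 |>.sub_const 1).ennreal_ofReal measurable_const
  exact (measurable_reds k) (MeasurableSet.of_discrete (s := {r : ℕ | (r : ℕ∞) ≤ y}))

lemma driftUpTo_eq_tsum (h : IsDrawLaw ν q) (y : ℕ∞) : driftUpTo ν q y =
    ∑' k, ∫⁻ s, (if (reds k s : ℕ∞) ≤ y then ENNReal.ofReal (2 * q k s - 1) else 0) ∂ν :=
  lintegral_tsum fun k => (h.measurable_drift_term y k).aemeasurable

lemma driftUpTo_mono : Monotone (driftUpTo ν q) := by
  intro y z hyz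
  refine lintegral_mono fun s => ENNReal.tsum_le_tsum fun k => ?_
  by_cases hk : (reds k s : ℕ∞) ≤ y
  · rw [if_pos hk, if_pos (hk.trans hyz)]
  · rw [if_neg hk]; exact zero_le

/-- Balance between red and blue draws up to the `(y + 1)`-th red one. -/
lemma lintegral_bluesBefore_add_driftUpTo [IsProbabilityMeasure ν] (h : IsDrawLaw ν q)
    (hq : ∀ n b, 1 / 2 ≤ q n b) (y : ℕ∞) :
    ∫⁻ s, (bluesBefore s y : ENNReal) ∂ν + driftUpTo ν q y = y + 1 := by
  by_cases hy : y = ⊤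
  · subst hy
    have : ∫⁻ s, (bluesBefore s ⊤ : ENNReal) ∂ν = ⊤ := by
      rw [lintegral_congr_ae (g := fun _ => ⊤)]
      · simp
      · filter_upwards [h.ae_isMixed] with s hs
        simp [hs.bluesBefore_top]
    simp [this]
  lift y to ℕ using hy
  -- `τ s` is the time of the `(y + 1)`-th red draw, with an arbitrary value on the null set of
  -- sequences that are not mixed.
  have hex : ∀ s, ∃ n, IsMixed s → reds n s = y ∧ s n = true := by
    intro s
    by_cases hs : IsMixed s
    · obtain ⟨n, hn⟩ := hs.exists_reds y
      exact ⟨n, fun _ => hn⟩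
    · exact ⟨0, fun h => absurd h hs⟩
  choose τ hτ using hex
  have hdep : ∀ (k : ℕ) (c a : Bool), DependsOn (fun s : ℕ → Bool =>
      (if (reds k s : ℕ∞) ≤ y then (if a = c then 1 else 0) else 0 : ENNReal)) (Set.Iio k) := by
    intro k c a s t hst
    simp only [dependsOn_reds k hst]
  have hmeas : ∀ (k : ℕ) (c : Bool), Measurable fun s : ℕ → Bool =>
      (if (reds k s : ℕ∞) ≤ y then (if s k = c then 1 else 0) else 0 : ENNReal) := by
    intro k c
    refine Measurable.ite ?_ (Measurable.ite (measurableSet_draw k c) measurable_const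
      measurable_const) measurable_const
    exact (measurable_reds k) (MeasurableSet.of_discrete (s := {r : ℕ | (r : ℕ∞) ≤ y}))
  have hsum : ∀ c, ∫⁻ s, ((Nat.count (fun k => s k = c) (τ s + 1) : ℕ) :
      ENNReal) ∂ν = ∑' k, ∫⁻ s, (if (reds k s : ℕ∞) ≤ y then (if s k = c then 1 else 0) else 0) ∂ν := by
    intro c
    rw [← lintegral_tsum fun k => (hmeas k c).aemeasurable]
    refine lintegral_congr_ae ?_
    filter_upwards [h.ae_isMixed] with s hs
    obtain ⟨h1, h2⟩ := hτ s hs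
    rw [← tsum_draws_upTo h2 c, h1]
  have hblue : ∫⁻ s, (bluesBefore s y : ENNReal) ∂ν =
      ∑' k, ∫⁻ s, (if (reds k s : ℕ∞) ≤ y then (if s k = false then 1 else 0) else 0) ∂ν := by
    rw [← hsum]
    refine lintegral_congr_ae ?_
    filter_upwards [h.ae_isMixed] with s hs
    obtain ⟨h1, h2⟩ := hτ s hs
    rw [← h1, bluesBefore_reds h2]
    have := blues_succ (τ s) s
    rw [h2] at this
    simp only [Bool.true_eq_false, if_false, add_zero] at this
    rw [← this]
    simp [blues]
  have hred : (y : ENNReal) + 1 =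
      ∑' k, ∫⁻ s, (if (reds k s : ℕ∞) ≤ y then (if s k = true then 1 else 0) else 0) ∂ν := by
    rw [← hsum]
    rw [lintegral_congr_ae (g := fun _ => (y : ENNReal) + 1)]
    · simp
    · filter_upwards [h.ae_isMixed] with s hs
      obtain ⟨h1, h2⟩ := hτ s hs
      have := reds_succ (τ s) s
      rw [if_pos h2, h1] at this
      rw [show Nat.count (fun k => s k = true) (τ s + 1) = y + 1 from this]
      push_cast
      rfl
  rw [hblue, h.driftUpTo_eq_tsum, ← ENNReal.tsum_add]
  simp only [ENat.toENNReal_coe]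
  rw [hred]
  refine tsum_congr fun k => ?_
  rw [h.lintegral_draw k (hdep k false), h.lintegral_draw k (hdep k true),
    ← lintegral_add_right _ (h.measurable_drift_term _ k)]
  refine lintegral_congr fun s => ?_
  by_cases hk : (reds k s : ℕ∞) ≤ y
  · simp only [if_pos hk]
    simp only [Bool.true_eq_false, Bool.false_eq_true, if_false, if_true, mul_zero, mul_one, zero_add, add_zero]
    -- Per draw the balance is `(1 - q) + (2q - 1) = q`; the bound `1 / 2 ≤ q` keeps
    -- `ENNReal.ofReal` from truncating the drift.
    rw [← ENNReal.ofReal_add (by linarith [h.le_one k s]) (by linarith [hq k s])]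
    congr 1
    ring
  · simp only [if_neg hk, mul_zero, add_zero]

end IsDrawLaw

/-! ### The stopped exponential functional -/

/-- The exponential functional of the draws, stopped after the `(y + 1)`-th red one. -/
noncomputable def stoppedGeom (m y : ℕ) : ℕ → (ℕ → Bool) → ℝ
  | 0, _ => (((m : ℝ) + 1) / (m + 2)) ^ (y + 1)
  | n + 1, s =>
    if reds n s ≤ y then
      stoppedGeom m y n s * (if s n = true then 1 + 1 / ((m : ℝ) + 1) else 1 - 1 / ((m : ℝ) + 1))
    else stoppedGeom m y n s

/-- The red factor `1 + 1/(m+1)` is the inverse of `(m+1)/(m+2)`, so each red draw cancels one of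
the `y + 1` initial factors, while each blue draw contributes `m/(m+1)`. -/
lemma stoppedGeom_eq {m y n : ℕ} {s : ℕ → Bool} (h : reds n s ≤ y) : stoppedGeom m y n s =
    (((m : ℝ) + 1) / (m + 2)) ^ (y + 1 - reds n s) * ((m : ℝ) / (m + 1)) ^ blues n s := by
  induction n with
  | zero => simp [stoppedGeom, reds_zero, blues_zero]
  | succ n ih =>
    have hn : reds n s ≤ y := (reds_mono s (Nat.le_succ n)).trans h
    rw [stoppedGeom, if_pos hn, ih hn, reds_succ, blues_succ]
    rw [reds_succ] at h
    have h1 : (m : ℝ) + 1 ≠ 0 := by positivity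
    have h2 : (m : ℝ) + 2 ≠ 0 := by positivity
    cases hs : s n
    · simp only [Bool.false_eq_true, if_false, if_true, add_zero, pow_succ, mul_assoc]
      congr 2
      field_simp
      ring
    · simp only [hs, Bool.true_eq_false, if_false, if_true, add_zero] at h ⊢
      obtain ⟨d, rfl⟩ : ∃ d, y = reds n s + 1 + d := ⟨y - (reds n s + 1), by omega⟩
      rw [show reds n s + 1 + d + 1 - reds n s = d + 2 by omega,
        show reds n s + 1 + d + 1 - (reds n s + 1) = d + 1 by omega, pow_succ _ (d + 1)]
      field_simp
      ring

lemma stoppedGeom_nonneg (m y n : ℕ) (s : ℕ → Bool) : 0 ≤ stoppedGeom m y n s := by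
  induction n with
  | zero => unfold stoppedGeom; positivity
  | succ n ih =>
    unfold stoppedGeom
    have h1 : 1 / ((m : ℝ) + 1) ≤ 1 := by
      rw [div_le_one (by positivity)]; linarith [(Nat.cast_nonneg m : (0 : ℝ) ≤ m)]
    split_ifs
    · exact mul_nonneg ih (by positivity)
    · exact mul_nonneg ih (by linarith)
    · exact ih

lemma stoppedGeom_le_one {m y n : ℕ} {s : ℕ → Bool} (h : reds n s ≤ y) :
    stoppedGeom m y n s ≤ 1 := by
  rw [stoppedGeom_eq h]
  refine mul_le_one₀ (pow_le_one₀ (by positivity) ?_) (pow_nonneg (ratio_nonneg m) _)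
    (pow_le_one₀ (ratio_nonneg m) (ratio_le_one m))
  rw [div_le_one (by positivity)]; linarith

lemma dependsOn_stoppedGeom (m y n : ℕ) : DependsOn (stoppedGeom m y n) (Set.Iio n) := by
  induction n with
  | zero => intro s t _; rfl
  | succ n ih =>
    intro s t hst
    have hst' : ∀ k ∈ Set.Iio n, s k = t k := fun k hk => hst k (Nat.lt_succ_of_lt hk)
    simp only [stoppedGeom]
    rw [ih hst', dependsOn_reds n hst', hst n (Nat.lt_succ_self n)]

lemma stoppedGeom_eventually {m n : ℕ} {s : ℕ → Bool} (h : s n = true) {k : ℕ} (hk : n + 1 ≤ k) :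
    stoppedGeom m (reds n s) k s = ((m : ℝ) / (m + 1)) ^ blues n s := by
  induction k, hk using Nat.le_induction with
  | base =>
    rw [stoppedGeom, if_pos le_rfl, stoppedGeom_eq le_rfl, if_pos h, Nat.add_sub_cancel_left]
    have h1 : (m : ℝ) + 1 ≠ 0 := by positivity
    have h2 : (m : ℝ) + 2 ≠ 0 := by positivity
    field_simp
    ring
  | succ k hk ih =>
    rw [stoppedGeom, if_neg, ih]
    have := reds_mono s hk
    simp only [reds_succ, if_pos h] at this
    omega

namespace IsDrawLaw

variable {ν : Measure (ℕ → Bool)} {q : ℕ → (ℕ → Bool) → ℝ}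

/-- One draw multiplies the functional on average by `1 + (2q - 1)/(m+1)`. Before stopping its value
is at most `1`, so the mean increase is at most the positive part of the drift divided by `m + 1`.
-/
lemma lintegral_stoppedGeom_succ_le [IsProbabilityMeasure ν] (h : IsDrawLaw ν q) (m y n : ℕ) :
    ∫⁻ s, ENNReal.ofReal (stoppedGeom m y (n + 1) s) ∂ν ≤
      ∫⁻ s, ENNReal.ofReal (stoppedGeom m y n s) ∂ν +
      (∫⁻ s, (if (reds n s : ℕ∞) ≤ y then ENNReal.ofReal (2 * q n s - 1) else 0) ∂ν) *
        ENNReal.ofReal (1 / ((m : ℝ) + 1)) := by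
  have hdep : ∀ a : Bool, DependsOn (fun s : ℕ → Bool => ENNReal.ofReal (if reds n s ≤ y then
      stoppedGeom m y n s * (if a = true then 1 + 1 / ((m : ℝ) + 1) else 1 - 1 / ((m : ℝ) + 1))
      else stoppedGeom m y n s)) (Set.Iio n) := by
    intro a s t hst
    simp only [dependsOn_reds n hst, dependsOn_stoppedGeom m y n hst]
  have h1 : 1 / ((m : ℝ) + 1) ≤ 1 := by
    rw [div_le_one (by positivity)]; linarith [(Nat.cast_nonneg m : (0 : ℝ) ≤ m)]
  have h0 : 0 < 1 / ((m : ℝ) + 1) := by positivity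
  have := h.lintegral_draw n hdep
  simp only [stoppedGeom]
  rw [this, ← lintegral_mul_const _ (h.measurable_drift_term y n),
    ← lintegral_add_right _ ((h.measurable_drift_term y n).mul_const _)]
  refine lintegral_mono fun s => ?_
  have hq0 := h.nonneg n s
  have hq1 := h.le_one n s
  have hB := stoppedGeom_nonneg m y n s
  by_cases hk : reds n s ≤ y
  · have hk' : (reds n s : ℕ∞) ≤ y := by exact_mod_cast hk
    have hB1 := stoppedGeom_le_one (m := m) hk
    simp only [if_pos hk, if_pos hk', if_true, Bool.false_eq_true, if_false]
    generalize stoppedGeom m y n s = B at *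
    generalize q n s = p at *
    generalize 1 / ((m : ℝ) + 1) = t at *
    rw [← ENNReal.ofReal_mul hq0, ← ENNReal.ofReal_mul (by linarith),
      ← ENNReal.ofReal_add (mul_nonneg hq0 (mul_nonneg hB (by linarith)))
        (mul_nonneg (by linarith) (mul_nonneg hB (by linarith))),
      ← ENNReal.ofReal_mul' h0.le]
    have hsplit : p * (B * (1 + t)) + (1 - p) * (B * (1 - t)) = B + B * ((2 * p - 1) * t) := by ring
    rw [hsplit]
    refine ENNReal.ofReal_add_le.trans (add_le_add le_rfl ?_)
    by_cases hp : 0 ≤ 2 * p - 1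
    · have := mul_nonneg hp h0.le
      exact ENNReal.ofReal_le_ofReal (by nlinarith)
    · have : B * ((2 * p - 1) * t) ≤ 0 :=
        mul_nonpos_of_nonneg_of_nonpos hB (mul_nonpos_of_nonpos_of_nonneg (by linarith) h0.le)
      rw [ENNReal.ofReal_of_nonpos this]
      exact zero_le
  · have hk' : ¬ (reds n s : ℕ∞) ≤ y := by exact_mod_cast hk
    simp only [if_neg hk, if_neg hk', zero_mul, add_zero]
    rw [← add_mul, ← ENNReal.ofReal_add hq0 (by linarith)]
    simp

/-- One step of the backward recursion against geometric weights. -/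
lemma lintegral_geomWeight_le [IsProbabilityMeasure ν] (h : IsDrawLaw ν q) (m : ℕ) (y : ℕ∞) :
    ∫⁻ s, geomWeight m (bluesBefore s y) ∂ν ≤
      geomWeight (m + 1) (y + 1) + driftUpTo ν q y * ENNReal.ofReal (1 / ((m : ℝ) + 1)) := by
  by_cases hy : y = ⊤
  · subst hy
    rw [lintegral_congr_ae (g := fun _ => 0)]
    · simp
    · filter_upwards [h.ae_isMixed] with s hs
      rw [hs.bluesBefore_top, geomWeight_top]
  lift y to ℕ using hy
  have hbound : ∀ n, ∫⁻ s, ENNReal.ofReal (stoppedGeom m y n s) ∂ν ≤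
      geomWeight (m + 1) (y + 1) + (∑ k ∈ Finset.range n,
        ∫⁻ s, (if (reds k s : ℕ∞) ≤ y then ENNReal.ofReal (2 * q k s - 1) else 0) ∂ν) *
        ENNReal.ofReal (1 / ((m : ℝ) + 1)) := by
    intro n
    induction n with
    | zero =>
      rw [show ((y : ℕ∞) + 1) = ((y + 1 : ℕ) : ℕ∞) by push_cast; rfl, geomWeight_coe]
      simp only [stoppedGeom, lintegral_const, measure_univ, mul_one]
      refine le_add_of_le_left (le_of_eq ?_)
      push_cast
      ring_nf
    | succ n ih =>
      refine (h.lintegral_stoppedGeom_succ_le m y n).trans ?_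
      rw [Finset.sum_range_succ, add_mul, ← add_assoc]
      gcongr
  have hmeas : ∀ n, Measurable fun s => ENNReal.ofReal (stoppedGeom m y n s) := fun n =>
    (dependsOn_stoppedGeom m y n).measurable_prefix.ennreal_ofReal
  -- The functional is eventually constant on mixed sequences; Fatou suffices since only an upper
  -- bound is needed.
  calc ∫⁻ s, geomWeight m (bluesBefore s y) ∂ν
      = ∫⁻ s, liminf (fun n => ENNReal.ofReal (stoppedGeom m y n s)) atTop ∂ν := by
        refine lintegral_congr_ae ?_
        filter_upwards [h.ae_isMixed] with s hs
        obtain ⟨n, rfl, hn⟩ := hs.exists_reds y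
        rw [bluesBefore_reds hn, geomWeight_coe]
        refine (Tendsto.liminf_eq (tendsto_atTop_of_eventually_const (i₀ := n + 1) ?_)).symm
        intro k hk
        rw [stoppedGeom_eventually hn hk]
    _ ≤ liminf (fun n => ∫⁻ s, ENNReal.ofReal (stoppedGeom m y n s) ∂ν) atTop :=
        lintegral_liminf_le hmeas
    _ ≤ liminf (fun _ : ℕ => geomWeight (m + 1) (y + 1) +
          driftUpTo ν q y * ENNReal.ofReal (1 / ((m : ℝ) + 1))) atTop := by
        refine liminf_le_liminf (Eventually.of_forall fun n => (hbound n).trans ?_)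
        gcongr
        rw [h.driftUpTo_eq_tsum]
        exact ENNReal.sum_le_tsum _
    _ = _ := by rw [liminf_const]

lemma driftUpTo_eq_zero (hq : ∀ n b, q n b ≤ 1 / 2) (y : ℕ∞) : driftUpTo ν q y = 0 := by
  unfold driftUpTo
  rw [lintegral_congr (g := fun _ => 0)]
  · simp
  · intro s
    rw [ENNReal.tsum_eq_zero]
    intro k
    split_ifs
    · exact ENNReal.ofReal_of_nonpos (by linarith [hq k s])
    · rfl

lemma driftUpTo_iSup {u : ℕ → ℕ∞} (hu : Monotone u) (h : IsDrawLaw ν q) :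
    driftUpTo ν q (⨆ j, u j) = ⨆ j, driftUpTo ν q (u j) := by
  simp only [driftUpTo]
  rw [← lintegral_iSup]
  · refine lintegral_congr fun s => ?_
    refine le_antisymm ?_ (iSup_le fun j => ENNReal.tsum_le_tsum fun k => ?_)
    · rw [ENNReal.tsum_eq_iSup_nat]
      refine iSup_le fun n => ?_
      -- A partial sum involves finitely many `k`, so one index `j` serves them all.
      have : ∃ j, ∀ k < n, (reds k s : ℕ∞) ≤ ⨆ i, u i → (reds k s : ℕ∞) ≤ u j := by
        induction n with
        | zero => exact ⟨0, by simp⟩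
        | succ n ih =>
          obtain ⟨j, hj⟩ := ih
          by_cases hn : (reds n s : ℕ∞) ≤ ⨆ i, u i
          · obtain ⟨i, hi⟩ := (natCast_le_iSup_iff _).1 hn
            refine ⟨max i j, fun k hk hk' => ?_⟩
            rcases Nat.lt_succ_iff_lt_or_eq.1 hk with h1 | rfl
            · exact (hj k h1 hk').trans (hu (le_max_right _ _))
            · exact hi.trans (hu (le_max_left _ _))
          · refine ⟨j, fun k hk hk' => ?_⟩
            rcases Nat.lt_succ_iff_lt_or_eq.1 hk with h1 | rfl
            · exact hj k h1 hk'
            · exact absurd hk' hn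
      obtain ⟨j, hj⟩ := this
      refine le_iSup_of_le j (le_trans (Finset.sum_le_sum fun k hk => ?_) (ENNReal.sum_le_tsum _))
      split_ifs with h1 h2
      · exact le_rfl
      · exact absurd (hj k (Finset.mem_range.1 hk) h1) h2
      · exact zero_le
      · exact le_rfl
    · split_ifs with h1 h2
      · exact le_rfl
      · exact absurd (h1.trans (le_iSup u j)) h2
      · exact zero_le
      · exact le_rfl
  · exact fun j => Measurable.tsum fun k => h.measurable_drift_term _ k
  · intro i j hij s
    refine ENNReal.tsum_le_tsum fun k => ?_
    split_ifs with h1 h2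
    · exact le_rfl
    · exact absurd (h1.trans (hu hij)) h2
    · exact zero_le
    · exact le_rfl

/-- The drift of the draw following a prefix with more than `y` reds is counted at `⊤` but not at
`y`. -/
lemma driftUpTo_add_le [IsProbabilityMeasure ν] (h : IsDrawLaw ν q) {y : ℕ} {b : ℕ → Bool} {n : ℕ}
    (hb : y < reds n b) :
    driftUpTo ν q y + ENNReal.ofReal (2 * q n b - 1) * ν (prefixSet b n) ≤ driftUpTo ν q ⊤ := by
  have h1 : ENNReal.ofReal (2 * q n b - 1) * ν (prefixSet b n) =
      ∫⁻ s, (prefixSet b n).indicator (fun _ => ENNReal.ofReal (2 * q n b - 1)) s ∂ν := by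
    rw [lintegral_indicator_const (measurableSet_prefixSet b n)]
  rw [h1, driftUpTo, driftUpTo, ← lintegral_add_left
    (Measurable.tsum fun k => h.measurable_drift_term _ k)]
  refine lintegral_mono fun s => ?_
  have h2 : (prefixSet b n).indicator (fun _ => ENNReal.ofReal (2 * q n b - 1)) s =
      ∑' k, if k = n then (prefixSet b n).indicator
        (fun _ => ENNReal.ofReal (2 * q n b - 1)) s else 0 := by
    rw [tsum_ite_eq]
  rw [h2, ← ENNReal.tsum_add]
  refine ENNReal.tsum_le_tsum fun k => ?_
  rw [if_pos le_top]
  by_cases hk : k = n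
  · subst hk
    rw [if_pos rfl]
    by_cases hs : s ∈ prefixSet b k
    · rw [Set.indicator_of_mem hs, if_neg, zero_add]
      · rw [h.dependsOn k (x := s) (y := b) fun i hi => hs i hi]
      · rw [reds_congr (t := b) fun i hi => hs i hi]
        exact_mod_cast hb.not_ge
    · rw [Set.indicator_of_notMem hs, add_zero]
      split_ifs
      · exact le_rfl
      · exact zero_le
  · rw [if_neg hk, add_zero]
    split_ifs
    · exact le_rfl
    · exact zero_le

end IsDrawLaw

/-! ### The backward recursion with independent draws -/

section Chain

variable {Ω : Type*} [MeasurableSpace Ω] {μ : Measure Ω} {S : ℕ → Ω → ℕ → Bool}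

lemma indepFun_zero_shift (hS : ∀ i, Measurable (S i)) (hi : iIndepFun S μ) :
    IndepFun (S 0) (fun ω i => S (i + 1) ω) μ := by
  have h := indep_iSup_of_disjoint (fun i => (hS i).comap_le) hi
    (S := {0}) (T := Set.Ici 1) (by simp)
  rw [IndepFun]
  refine indep_of_indep_of_le_left (indep_of_indep_of_le_right h ?_) ?_
  · rw [← measurable_iff_comap_le]
    refine @measurable_pi_lambda _ _ _ (_) _ _ fun i => ?_
    rw [measurable_iff_comap_le]
    exact le_iSup₂_of_le (f := fun i (_ : i ∈ Set.Ici 1) =>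
      MeasurableSpace.comap (S i) inferInstance) (i + 1) (by simp) le_rfl
  · simp

lemma lintegral_zero_shift [IsProbabilityMeasure μ] (hS : ∀ i, Measurable (S i))
    (hi : iIndepFun S μ) {Φ : (ℕ → Bool) × (ℕ → ℕ → Bool) → ENNReal} (hΦ : Measurable Φ) :
    ∫⁻ ω, Φ (S 0 ω, fun i => S (i + 1) ω) ∂μ =
      ∫⁻ ω, ∫⁻ s, Φ (s, fun i => S (i + 1) ω) ∂(μ.map (S 0)) ∂μ := by
  have hT : Measurable fun ω i => S (i + 1) ω := measurable_pi_lambda _ fun i => hS (i + 1)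
  have h := (indepFun_iff_map_prod_eq_prod_map_map (hS 0).aemeasurable hT.aemeasurable).1
    (indepFun_zero_shift hS hi)
  have : IsProbabilityMeasure (μ.map (S 0)) :=
    Measure.isProbabilityMeasure_map (hS 0).aemeasurable
  have : IsProbabilityMeasure (μ.map fun ω i => S (i + 1) ω) :=
    Measure.isProbabilityMeasure_map hT.aemeasurable
  rw [← lintegral_map (μ := μ) (g := fun ω => (S 0 ω, fun i => S (i + 1) ω)) hΦ
    ((hS 0).prodMk hT), h, lintegral_prod_symm _ hΦ.aemeasurable, lintegral_map _ hT]
  exact hΦ.lintegral_prod_left'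

lemma iIndepFun_shift (hi : iIndepFun S μ) : iIndepFun (fun i => S (i + 1)) μ :=
  hi.precomp (g := fun i : ℕ => i + 1) (add_left_injective 1)

lemma map_shift_eq [IsProbabilityMeasure μ] (hS : ∀ i, Measurable (S i)) (hi : iIndepFun S μ)
    {ν : Measure (ℕ → Bool)} (hν : ∀ i, μ.map (S i) = ν) :
    μ.map (fun ω i => S (i + 1) ω) = μ.map (fun ω i => S i ω) := by
  rw [hi.map_fun_eq_infinitePi_map hS,
    (iIndepFun_shift hi).map_fun_eq_infinitePi_map fun i => hS (i + 1)]
  simp only [hν]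

lemma lintegral_shift_eq [IsProbabilityMeasure μ] (hS : ∀ i, Measurable (S i)) (hi : iIndepFun S μ)
    {ν : Measure (ℕ → Bool)} (hν : ∀ i, μ.map (S i) = ν) {F : (ℕ → ℕ → Bool) → ENNReal}
    (hF : Measurable F) : ∫⁻ ω, F (fun i => S (i + 1) ω) ∂μ = ∫⁻ ω, F (fun i => S i ω) ∂μ := by
  rw [← lintegral_map hF (measurable_pi_lambda _ fun i => hS (i + 1)), map_shift_eq hS hi hν,
    lintegral_map hF (measurable_pi_lambda _ hS)]

lemma ae_isMixed_of_law (hS : ∀ i, Measurable (S i)) [IsProbabilityMeasure μ]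
    (hq : ∀ i, ∃ q, IsDrawLaw (μ.map (S i)) q) : ∀ᵐ ω ∂μ, ∀ i, IsMixed (S i ω) := by
  rw [ae_all_iff]
  intro i
  obtain ⟨q, hq⟩ := hq i
  have : IsProbabilityMeasure (μ.map (S i)) := Measure.isProbabilityMeasure_map (hS i).aemeasurable
  exact ae_of_ae_map (hS i).aemeasurable hq.ae_isMixed

/-- Finiteness of the limit is a tail event. -/
lemma ae_backwardLim_zero_one [IsProbabilityMeasure μ] (hS : ∀ i, Measurable (S i))
    (hi : iIndepFun S μ) (hq : ∀ i, ∃ q, IsDrawLaw (μ.map (S i)) q) :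
    (∀ᵐ ω ∂μ, backwardLim (fun i => S i ω) = ⊤) ∨ ∀ᵐ ω ∂μ, backwardLim (fun i => S i ω) < ⊤ := by
  set E : ℕ → Set Ω := fun n => {ω | backwardLim (fun i => S (i + n) ω) < ⊤} with hE
  -- For mixed draws `bluesBefore` is finite exactly at finite arguments, so discarding the first
  -- sites does not affect finiteness.
  have hstep : ∀ᵐ ω ∂μ, ∀ n, ω ∈ E n ↔ ω ∈ E 0 := by
    filter_upwards [ae_isMixed_of_law hS hq] with ω hω n
    induction n with
    | zero => rfl
    | succ n ih =>
      rw [← ih]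
      simp only [hE, mem_ofPred_eq]
      rw [backwardLim_eq fun i => S (i + n) ω]
      have hfun : (fun i => S (i + (n + 1)) ω) = fun i => S (i + 1 + n) ω := by
        funext i; rw [add_right_comm, add_assoc]
      rw [hfun]
      constructor
      · exact fun h => (hω _).bluesBefore_lt_top h
      · intro h
        by_contra hlt
        rw [not_lt_top_iff.1 hlt, (hω _).bluesBefore_top] at h
        exact lt_irrefl _ h
  have htail : MeasurableSet[limsup (fun i => MeasurableSpace.comap (S i) inferInstance) atTop]
      (limsup E atTop) := by
    rw [limsup_eq_iInf_iSup_of_nat, MeasurableSpace.measurableSet_iInf]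
    intro N
    rw [← limsup_nat_add E N]
    refine @MeasurableSet.measurableSet_limsup _ (_) _ fun n => ?_
    have hmeas : Measurable[⨆ i, ⨆ (_ : i ≥ N), MeasurableSpace.comap (S i) inferInstance]
        fun ω i => S (i + (n + N)) ω := by
      refine @measurable_pi_lambda _ _ _ (_) _ _ fun i => ?_
      rw [measurable_iff_comap_le]
      exact le_iSup₂_of_le (f := fun i (_ : i ≥ N) =>
        MeasurableSpace.comap (S i) inferInstance) (i + (n + N)) (by omega) le_rfl
    exact (measurable_backwardLim.comp hmeas) (MeasurableSet.of_discrete (s := Set.Iio ⊤))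
  have hae : ∀ᵐ ω ∂μ, ω ∈ limsup E atTop ↔ ω ∈ E 0 := by
    filter_upwards [hstep] with ω hω
    rw [mem_limsup_iff_frequently_mem]
    simp [hω]
  have hmE : NullMeasurableSet (limsup E atTop) μ := by
    refine MeasurableSet.nullMeasurableSet (MeasurableSet.measurableSet_limsup fun n => ?_)
    exact (measurable_backwardLim.comp (measurable_pi_lambda _ fun i => hS (i + n)))
      (MeasurableSet.of_discrete (s := Set.Iio ⊤))
  rcases measure_zero_or_one_of_measurableSet_limsup_atTop (fun i => (hS i).comap_le) hi htail
    with h | h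
  · left
    have h' : ∀ᵐ ω ∂μ, ω ∉ limsup E atTop := measure_eq_zero_iff_ae_notMem.1 h
    filter_upwards [hae, h'] with ω h1 h2
    rw [h1] at h2
    exact not_lt_top_iff.1 h2
  · right
    have h' : ∀ᵐ ω ∂μ, ω ∈ limsup E atTop := (mem_ae_iff_prob_eq_one₀ hmE).2 h
    filter_upwards [hae, h'] with ω h1 h2
    exact h1.1 h2

lemma measurable_geomWeight (m : ℕ) : Measurable (geomWeight m) := Measurable.of_discrete

lemma measurable_driftUpTo {ν : Measure (ℕ → Bool)} {q : ℕ → (ℕ → Bool) → ℝ} :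
    Measurable (driftUpTo ν q) := Measurable.of_discrete

/-- The one-step bound averaged over the other sites. The `+ 1` in `y + 1` yields the prefactor
`(m+1)/(m+2)`, on which all later decay rests. -/
lemma lintegral_geomWeight_step [IsProbabilityMeasure μ] (hS : ∀ i, Measurable (S i))
    (hi : iIndepFun S μ) {q : ℕ → (ℕ → Bool) → ℝ} (hq : IsDrawLaw (μ.map (S 0)) q)
    {y : (ℕ → ℕ → Bool) → ℕ∞} (hy : Measurable y) (m : ℕ) :
    ∫⁻ ω, geomWeight m (bluesBefore (S 0 ω) (y fun i => S (i + 1) ω)) ∂μ ≤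
      ENNReal.ofReal (((m : ℝ) + 1) / (m + 2)) *
        ∫⁻ ω, geomWeight (m + 1) (y fun i => S (i + 1) ω) ∂μ +
      (∫⁻ ω, driftUpTo (μ.map (S 0)) q (y fun i => S (i + 1) ω) ∂μ) *
        ENNReal.ofReal (1 / ((m : ℝ) + 1)) := by
  have : IsProbabilityMeasure (μ.map (S 0)) :=
    Measure.isProbabilityMeasure_map (hS 0).aemeasurable
  have hT : Measurable fun ω i => S (i + 1) ω := measurable_pi_lambda _ fun i => hS (i + 1)
  have hΦ : Measurable fun p : (ℕ → Bool) × (ℕ → ℕ → Bool) =>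
      geomWeight m (bluesBefore p.1 (y p.2)) :=
    (measurable_geomWeight m).comp
      (measurable_bluesBefore.comp (measurable_fst.prodMk (hy.comp measurable_snd)))
  have hA : Measurable fun ω => geomWeight (m + 1) (y fun i => S (i + 1) ω) :=
    (measurable_geomWeight (m + 1)).comp (hy.comp hT)
  have hB : Measurable fun ω => driftUpTo (μ.map (S 0)) q (y fun i => S (i + 1) ω) :=
    measurable_driftUpTo.comp (hy.comp hT)
  rw [lintegral_zero_shift hS hi hΦ, ← lintegral_const_mul _ hA, ← lintegral_mul_const _ hB,
    ← lintegral_add_left (hA.const_mul _)]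
  refine lintegral_mono fun ω => ?_
  refine (hq.lintegral_geomWeight_le m (y fun i => S (i + 1) ω)).trans (le_of_eq ?_)
  rw [geomWeight_add_one]
  push_cast
  congr 4
  ring

/-- Without drift towards red, the backward recursion diverges. -/
lemma ae_backwardLim_eq_top_of_le_half [IsProbabilityMeasure μ] (hS : ∀ i, Measurable (S i))
    (hi : iIndepFun S μ) (hq : ∀ i, ∃ q, IsDrawLaw (μ.map (S i)) q ∧ ∀ n b, q n b ≤ 1 / 2) :
    ∀ᵐ ω ∂μ, backwardLim (fun i => S i ω) = ⊤ := by
  -- Each step raises `m` by one, so `m` stays free in the induction and the prefactors telescope.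
  have key : ∀ j m, ∫⁻ ω, geomWeight m (backward j fun i => S i ω) ∂μ ≤
      ENNReal.ofReal (((m : ℝ) + 1) / (m + 1 + j)) := by
    intro j
    induction j generalizing S with
    | zero =>
      intro m
      have h1 : ((m : ℝ) + 1) / (m + 1 + (0 : ℕ)) = 1 := by
        rw [Nat.cast_zero, add_zero, div_self (by positivity)]
      rw [h1, ENNReal.ofReal_one]
      calc _ ≤ ∫⁻ _, 1 ∂μ := lintegral_mono fun ω => geomWeight_le_one m _
        _ = 1 := by simp
    | succ j ih =>
      intro m
      obtain ⟨q, hq0, hq1⟩ := hq 0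
      have h := lintegral_geomWeight_step hS hi hq0 (measurable_backward j) m
      simp only [IsDrawLaw.driftUpTo_eq_zero hq1, lintegral_zero, zero_mul, add_zero] at h
      refine h.trans ?_
      have h2 := ih (fun i => hS (i + 1)) (iIndepFun_shift hi) (fun i => hq (i + 1)) (m + 1)
      calc _ ≤ _ := mul_le_mul_right h2 _
        _ = _ := by
          rw [← ENNReal.ofReal_mul (by positivity)]
          congr 1
          push_cast
          field_simp
          ring
  have hm : Measurable fun ω => geomWeight 1 (backwardLim fun i => S i ω) :=
    (measurable_geomWeight 1).comp (measurable_backwardLim.comp (measurable_pi_lambda _ hS))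
  have hzero : ∫⁻ ω, geomWeight 1 (backwardLim fun i => S i ω) ∂μ = 0 := by
    refine le_antisymm (ge_of_tendsto' (f := fun j : ℕ => ENNReal.ofReal (2 / (2 + (j : ℝ)))) (x := atTop) ?_ fun j => ?_)
      zero_le
    · rw [← ENNReal.ofReal_zero]
      refine ENNReal.tendsto_ofReal (Tendsto.const_div_atTop ?_ _)
      exact tendsto_atTop_add_const_left _ _ tendsto_natCast_atTop_atTop
    · refine (lintegral_mono fun ω => geomWeight_antitone 1 (le_iSup _ j)).trans
        ((key j 1).trans (le_of_eq ?_))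
      norm_num
  filter_upwards [(lintegral_eq_zero_iff hm).1 hzero] with ω hω
  by_contra hne
  obtain ⟨n, hn⟩ := ENat.ne_top_iff_exists.1 hne
  simp only [← hn, geomWeight_coe, Pi.zero_apply, ENNReal.ofReal_eq_zero] at hω
  have : (0 : ℝ) < (((1 : ℕ) : ℝ) / ((1 : ℕ) + 1)) ^ n := by positivity
  linarith

/-- If the backward recursion diverges then the mean total drift is at most `1`. -/
lemma driftUpTo_top_le_one [IsProbabilityMeasure μ] (hS : ∀ i, Measurable (S i))
    (hi : iIndepFun S μ) {ν : Measure (ℕ → Bool)} [IsProbabilityMeasure ν]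
    (hν : ∀ i, μ.map (S i) = ν) {q : ℕ → (ℕ → Bool) → ℝ} (hq : IsDrawLaw ν q)
    (hhalf : ∀ n b, 1 / 2 ≤ q n b) (htop : ∀ᵐ ω ∂μ, backwardLim (fun i => S i ω) = ⊤) :
    driftUpTo ν q ⊤ ≤ 1 := by
  have hSm : Measurable fun ω i => S i ω := measurable_pi_lambda _ hS
  set e : ℕ → ENNReal := fun j => ∫⁻ ω, (backward j (fun i => S i ω) : ENNReal) ∂μ with he
  set d : ℕ → ENNReal := fun j => ∫⁻ ω, driftUpTo ν q (backward j fun i => S i ω) ∂μ with hd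
  have hcast : Measurable fun y : ℕ∞ => (y : ENNReal) := Measurable.of_discrete
  have hstep : ∀ j, e (j + 1) + d j = e j + 1 := by
    intro j
    have hΦ : Measurable fun p : (ℕ → Bool) × (ℕ → ℕ → Bool) =>
        (bluesBefore p.1 (backward j p.2) : ENNReal) :=
      hcast.comp (measurable_bluesBefore.comp
        (measurable_fst.prodMk ((measurable_backward j).comp measurable_snd)))
    have h1 := lintegral_zero_shift hS hi hΦ
    have h2 : d j = ∫⁻ ω, driftUpTo ν q (backward j fun i => S (i + 1) ω) ∂μ :=
      (lintegral_shift_eq hS hi hν (measurable_driftUpTo.comp (measurable_backward j))).symm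
    have h3 : e j = ∫⁻ ω, (backward j (fun i => S (i + 1) ω) : ENNReal) ∂μ :=
      (lintegral_shift_eq hS hi hν (hcast.comp (measurable_backward j))).symm
    have hT : Measurable fun ω i => S (i + 1) ω := measurable_pi_lambda _ fun i => hS (i + 1)
    have h4 : e (j + 1) = ∫⁻ ω, ∫⁻ s, (bluesBefore s (backward j fun i => S (i + 1) ω) : ENNReal)
        ∂ν ∂μ := by
      rw [← hν 0]; exact h1
    have hB : Measurable fun ω => driftUpTo ν q (backward j fun i => S (i + 1) ω) :=
      measurable_driftUpTo.comp ((measurable_backward j).comp hT)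
    rw [h4, h2, ← lintegral_add_right _ hB]
    simp only [hq.lintegral_bluesBefore_add_driftUpTo hhalf]
    rw [lintegral_add_right _ measurable_const, ← h3]
    simp
  have hsup : ⨆ j, d j = driftUpTo ν q ⊤ := by
    have hB : ∀ j, Measurable fun ω => driftUpTo ν q (backward j fun i => S i ω) := fun j =>
      measurable_driftUpTo.comp ((measurable_backward j).comp hSm)
    simp only [hd]
    rw [← lintegral_iSup hB (fun i j hij ω => IsDrawLaw.driftUpTo_mono (backward_mono _ hij))]
    rw [lintegral_congr_ae (g := fun _ => driftUpTo ν q ⊤)]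
    · simp
    · filter_upwards [htop] with ω hω
      rw [← hω, backwardLim, hq.driftUpTo_iSup (backward_mono _)]
  by_contra hlt
  rw [not_le, ← hsup, lt_iSup_iff] at hlt
  obtain ⟨j, hj⟩ := hlt
  have hdmono : Monotone d := fun i j hij =>
    lintegral_mono fun ω => IsDrawLaw.driftUpTo_mono (backward_mono _ hij)
  have hfin : ∀ j, e j < ⊤ := by
    intro j
    induction j with
    | zero => simp [he, backward]
    | succ j ih =>
      exact lt_of_le_of_lt (le_self_add.trans (hstep j).le) (ENNReal.add_lt_top.2 ⟨ih, by simp⟩)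
  have hdfin : d j < ⊤ := lt_of_le_of_lt (le_add_self.trans (hstep j).le)
    (ENNReal.add_lt_top.2 ⟨hfin j, by simp⟩)
  -- As `d` is increasing, from index `j` on each step lowers the mean by at least `d j - 1 > 0`.
  have hdec : ∀ k : ℕ, (e (j + k)).toReal + k * ((d j).toReal - 1) ≤ (e j).toReal := by
    intro k
    induction k with
    | zero => simp
    | succ k ih =>
      have h1 : e (j + k + 1) + d j ≤ e (j + k) + 1 :=
        (add_le_add le_rfl (hdmono (Nat.le_add_right j k))).trans (hstep (j + k)).le
      have h2 := ENNReal.toReal_mono (ENNReal.add_lt_top.2 ⟨hfin _, by simp⟩).ne h1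
      rw [ENNReal.toReal_add (hfin _).ne hdfin.ne, ENNReal.toReal_add (hfin _).ne (by simp)] at h2
      simp only [ENNReal.toReal_one] at h2
      push_cast
      rw [← add_assoc]
      linarith
  have hgap : 0 < (d j).toReal - 1 := by
    have := (ENNReal.toReal_lt_toReal (by simp) hdfin.ne).2 hj
    simp only [ENNReal.toReal_one] at this
    linarith
  obtain ⟨k, hk⟩ := exists_nat_gt ((e j).toReal / ((d j).toReal - 1))
  rw [div_lt_iff₀ hgap] at hk
  have := hdec k
  have h0 : 0 ≤ (e (j + k)).toReal := ENNReal.toReal_nonneg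
  linarith

/-- If the mean drift up to any red draw is less than `1`, the backward recursion cannot have a
finite limit. -/
lemma not_ae_backwardLim_lt_top [IsProbabilityMeasure μ] (hS : ∀ i, Measurable (S i))
    (hi : iIndepFun S μ) {ν : Measure (ℕ → Bool)} [IsProbabilityMeasure ν]
    (hν : ∀ i, μ.map (S i) = ν) {q : ℕ → (ℕ → Bool) → ℝ} (hq : IsDrawLaw ν q)
    (hdrift : ∀ y : ℕ, driftUpTo ν q y < 1) :
    ¬ ∀ᵐ ω ∂μ, backwardLim (fun i => S i ω) < ⊤ := by
  intro hlim
  have hSm : Measurable fun ω i => S i ω := measurable_pi_lambda _ hS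
  have hLm : Measurable fun ω => backwardLim fun i => S i ω := measurable_backwardLim.comp hSm
  set e : ENNReal := ∫⁻ ω, driftUpTo ν q (backwardLim fun i => S i ω) ∂μ with he
  set H : ℕ → ENNReal := fun m => ∫⁻ ω, geomWeight m (backwardLim fun i => S i ω) ∂μ with hH
  have he1 : e < 1 := by
    have hlt : ∀ᵐ ω ∂μ, driftUpTo ν q (backwardLim fun i => S i ω) < 1 := by
      filter_upwards [hlim] with ω hω
      obtain ⟨n, hn⟩ := ENat.ne_top_iff_exists.1 hω.ne
      rw [← hn]
      exact hdrift n
    have hle : e ≤ ∫⁻ _, 1 ∂μ := lintegral_mono_ae (hlt.mono fun _ h => h.le)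
    have := lintegral_strict_mono (μ := μ) (f := fun ω => driftUpTo ν q (backwardLim fun i => S i ω))
      (g := fun _ => 1) (IsProbabilityMeasure.ne_zero μ) aemeasurable_const
      (ne_top_of_le_ne_top (by simp) hle) hlt
    simpa using this
  have hH1 : ∀ m, H m ≤ 1 := fun m => by
    calc H m ≤ ∫⁻ _, 1 ∂μ := lintegral_mono fun ω => geomWeight_le_one m _
      _ = 1 := by simp
  have hstep : ∀ m : ℕ, H m ≤ ENNReal.ofReal (((m : ℝ) + 1) / (m + 2)) * H (m + 1) +
      e * ENNReal.ofReal (1 / ((m : ℝ) + 1)) := by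
    intro m
    have h1 := lintegral_geomWeight_step hS hi (q := q) (by rw [hν 0]; exact hq)
      measurable_backwardLim m
    have hA : ∫⁻ ω, geomWeight (m + 1) (backwardLim fun i => S (i + 1) ω) ∂μ = H (m + 1) :=
      lintegral_shift_eq hS hi hν ((measurable_geomWeight (m + 1)).comp measurable_backwardLim)
    have hB : ∫⁻ ω, driftUpTo ν q (backwardLim fun i => S (i + 1) ω) ∂μ = e :=
      lintegral_shift_eq hS hi hν
      ((measurable_driftUpTo (ν := ν) (q := q)).comp measurable_backwardLim)
    rw [hν 0, hA, hB] at h1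
    have hE : H m = ∫⁻ ω, geomWeight m (bluesBefore (S 0 ω) (backwardLim fun i => S (i + 1) ω)) ∂μ :=
      lintegral_congr fun ω => by rw [backwardLim_eq fun i => S i ω]
    rw [hE]
    exact h1
  have hstep' : ∀ m : ℕ, (H m).toReal ≤ ((m : ℝ) + 1) / (m + 2) * (H (m + 1)).toReal +
      e.toReal * (1 / ((m : ℝ) + 1)) := by
    intro m
    have hA : ENNReal.ofReal (((m : ℝ) + 1) / (m + 2)) * H (m + 1) ≠ ⊤ :=
      ENNReal.mul_ne_top ENNReal.ofReal_ne_top (ne_top_of_le_ne_top (by simp) (hH1 _))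
    have hB : e * ENNReal.ofReal (1 / ((m : ℝ) + 1)) ≠ ⊤ :=
      ENNReal.mul_ne_top (ne_top_of_lt he1) ENNReal.ofReal_ne_top
    have := ENNReal.toReal_mono (ENNReal.add_ne_top.2 ⟨hA, hB⟩) (hstep m)
    rwa [ENNReal.toReal_add hA hB, ENNReal.toReal_mul, ENNReal.toReal_mul,
      ENNReal.toReal_ofReal (by positivity), ENNReal.toReal_ofReal (by positivity)] at this
  have he1' : e.toReal < 1 := by
    have := (ENNReal.toReal_lt_toReal (ne_top_of_lt he1) (by simp)).2 he1
    simpa using this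
  have he0 : 0 ≤ e.toReal := ENNReal.toReal_nonneg
  have hH1' : ∀ m, (H m).toReal ≤ 1 := fun m => by
    have := ENNReal.toReal_mono (by simp) (hH1 m)
    simpa using this
  have hH0' : ∀ m, 0 ≤ (H m).toReal := fun m => ENNReal.toReal_nonneg
  have hlimH : Tendsto (fun m => (H m).toReal) atTop (𝓝 1) := by
    have hpt : ∀ᵐ ω ∂μ, Tendsto (fun m => geomWeight m (backwardLim fun i => S i ω)) atTop
        (𝓝 1) := by
      filter_upwards [hlim] with ω hω
      obtain ⟨n, hn⟩ := ENat.ne_top_iff_exists.1 hω.ne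
      simp only [← hn, geomWeight_coe]
      have := (tendsto_natCast_div_add_atTop (1 : ℝ)).pow n
      rw [one_pow] at this
      rw [← ENNReal.ofReal_one]
      exact ENNReal.tendsto_ofReal this
    have := tendsto_lintegral_of_dominated_convergence (μ := μ) (fun _ => 1)
      (fun m => (measurable_geomWeight m).comp hLm)
      (fun m => Eventually.of_forall fun ω => geomWeight_le_one m _) (by simp) hpt
    have h2 := (ENNReal.tendsto_toReal (by simp)).comp this
    simpa [Function.comp_def, hH] using h2
  -- Dividing `hstep'` at `k + 1` by `k + 2` leaves the error `e/(k+2)^2`, which is at most `e/(k+1)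
  -- - e/(k+2)`. So `a` increases; its limit is `0`, hence `a ≤ 0`.
  set a : ℕ → ℝ := fun k => (H (k + 1)).toReal / (k + 2) - e.toReal / (k + 1) with ha
  have hmono : Monotone a := by
    refine monotone_nat_of_le_succ fun k => ?_
    simp only [ha]
    push_cast
    have h1 := hstep' (k + 1)
    push_cast at h1
    have hk : (0 : ℝ) ≤ k := Nat.cast_nonneg k
    have h2 : (H (k + 1)).toReal / (k + 2) ≤ (H (k + 1 + 1)).toReal / (k + 1 + 2) +
        e.toReal / ((k : ℝ) + 2) ^ 2 := by
      rw [div_le_iff₀ (by positivity)]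
      refine h1.trans (le_of_eq ?_)
      field_simp
      ring
    have h3 : e.toReal / ((k : ℝ) + 2) ^ 2 ≤ e.toReal / (k + 1) - e.toReal / (k + 1 + 1) := by
      rw [div_sub_div _ _ (by positivity) (by positivity), div_le_div_iff₀ (by positivity) (by positivity)]
      nlinarith
    linarith
  have hlima : Tendsto a atTop (𝓝 0) := by
    have hnat : Tendsto (fun k : ℕ => (k : ℝ)) atTop atTop := tendsto_natCast_atTop_atTop
    have h1 := ((tendsto_add_atTop_iff_nat 1).2 hlimH).div_atTop
      (tendsto_atTop_add_const_right _ (2 : ℝ) hnat)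
    have h2 := (tendsto_const_nhds (x := e.toReal)).div_atTop
      (tendsto_atTop_add_const_right _ (1 : ℝ) hnat)
    simpa using h1.sub h2
  have hle : ∀ k : ℕ, (H (k + 1)).toReal ≤ e.toReal * (((k + 1 : ℕ) + 1 : ℝ) / (k + 1 : ℕ)) := by
    intro k
    have h1 := hmono.ge_of_tendsto hlima k
    simp only [ha, sub_nonpos] at h1
    rw [div_le_div_iff₀ (by positivity) (by positivity)] at h1
    push_cast
    rw [← mul_div_assoc, le_div_iff₀ (by positivity)]
    linarith
  have hfinal : Tendsto (fun k : ℕ => e.toReal * (((k + 1 : ℕ) + 1 : ℝ) / (k + 1 : ℕ))) atTop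
      (𝓝 (e.toReal * 1)) := by
    refine Tendsto.const_mul _ ?_
    refine (tendsto_add_atTop_iff_nat (f := fun n : ℕ => ((n : ℝ) + 1) / (n : ℝ)) 1).2 ?_
    have := (tendsto_natCast_div_add_atTop (1 : ℝ)).inv₀ one_ne_zero
    simpa using this
  have := le_of_tendsto_of_tendsto' ((tendsto_add_atTop_iff_nat 1).2 hlimH) hfinal hle
  linarith

end Chain

/-! ### Draws of an urn process -/

/-- The proportion of red balls after `n` draws, read off the draws. -/
noncomputable def urnState (a l : ℝ) (n : ℕ) (s : ℕ → Bool) : ℝ := (l * a + reds n s) / (l + n)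

open Classical in
/-- The colours of the successive balls drawn from an urn (`true` is red). -/
noncomputable def draws (l : ℝ) (α : ℕ → ℝ) (k : ℕ) : Bool :=
  decide (α (k + 1) = redUpdate (α k) (l + k))

lemma draws_eq_true_iff {l : ℝ} {α : ℕ → ℝ} {k : ℕ} :
    draws l α k = true ↔ α (k + 1) = redUpdate (α k) (l + k) := by simp [draws]

lemma urnState_mem {a l : ℝ} (ha : a ∈ Set.Icc (0 : ℝ) 1) (hl : 0 < l) (n : ℕ) (s : ℕ → Bool) :
    urnState a l n s ∈ Set.Icc (0 : ℝ) 1 := by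
  have h1 : (reds n s : ℝ) ≤ n := by
    have := reds_add_blues n s
    exact_mod_cast (by omega : reds n s ≤ n)
  have h2 := mul_nonneg hl.le ha.1
  unfold urnState
  refine ⟨by positivity, ?_⟩
  rw [div_le_one (by positivity)]
  nlinarith [ha.2]

lemma urnState_zero {a l : ℝ} (hl : 0 < l) (s : ℕ → Bool) : urnState a l 0 s = a := by
  simp [urnState, reds_zero, hl.ne']

lemma urnState_succ {a l : ℝ} (hl : 0 < l) (n : ℕ) (s : ℕ → Bool) : urnState a l (n + 1) s =
    if s n = true then redUpdate (urnState a l n s) (l + n)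
    else blueUpdate (urnState a l n s) (l + n) := by
  have h1 : l + (n : ℝ) ≠ 0 := by positivity
  have h2 : l + (n : ℝ) + 1 ≠ 0 := by positivity
  have h3 : l + ((n : ℝ) + 1) ≠ 0 := by positivity
  unfold urnState redUpdate blueUpdate
  rw [reds_succ]
  cases s n
  · simp only [Bool.false_eq_true, if_false]
    push_cast
    field_simp
    ring
  · simp only [if_true]
    push_cast
    field_simp
    ring

lemma dependsOn_urnState (a l : ℝ) (n : ℕ) : DependsOn (urnState a l n) (Set.Iio n) := by
  intro s t hst
  unfold urnState
  rw [dependsOn_reds n hst]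

lemma measurable_draws {Ω : Type*} [MeasurableSpace Ω] (l : ℝ) {α : ℕ → Ω → ℝ} {k : ℕ}
    (h0 : Measurable (α k)) (h1 : Measurable (α (k + 1))) :
    Measurable fun ω => draws l (fun n => α n ω) k := by
  refine measurable_to_bool ?_
  have : (fun ω => draws l (fun n => α n ω) k) ⁻¹' {true} =
      {ω | α (k + 1) ω = redUpdate (α k ω) (l + k)} := by
    ext ω; simp [draws_eq_true_iff]
  rw [this]
  refine measurableSet_eq_fun h1 ?_
  unfold redUpdate
  exact ((h0.const_mul _).add_const 1).div_const _

lemma measurableSet_draws_prefix {Ω : Type*} [MeasurableSpace Ω] (l : ℝ) {α : ℕ → Ω → ℝ} {n : ℕ}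
    (h : ∀ j ≤ n, Measurable (α j)) (b : ℕ → Bool) :
    MeasurableSet {ω | draws l (fun k => α k ω) ∈ prefixSet b n} := by
  have : {ω | draws l (fun k => α k ω) ∈ prefixSet b n} =
      ⋂ k, ⋂ (_ : k < n), {ω | draws l (fun k => α k ω) k = b k} := by
    ext ω; simp [prefixSet]
  rw [this]
  exact MeasurableSet.iInter fun k => MeasurableSet.iInter fun hk =>
    measurableSet_eq_fun (measurable_draws l (h k (Nat.le_of_lt hk)) (h (k + 1) hk)) measurable_const

lemma measurable_history {Ω : Type*} {α : ℕ → Ω → ℝ} {j n : ℕ} (hj : j ≤ n) :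
    Measurable[history α n] (α j) := by
  rw [measurable_iff_comap_le]
  exact le_iSup₂_of_le (f := fun j (_ : j ∈ Set.Iic n) =>
    MeasurableSpace.comap (α j) inferInstance) j hj le_rfl

namespace IsUrnProcess

variable {Ω : Type*} [MeasurableSpace Ω] {μ : Measure Ω} {f : ℝ → ℝ} {a l : ℝ} {α : ℕ → Ω → ℝ}

lemma history_le (h : IsUrnProcess μ f a l α) (n : ℕ) : history α n ≤ ‹MeasurableSpace Ω› :=
  iSup₂_le fun j _ => (h.measurable j).comap_le

lemma measurable_draws (h : IsUrnProcess μ f a l α) :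
    Measurable fun ω => draws l (fun n => α n ω) :=
  measurable_pi_lambda _ fun k => _root_.measurable_draws l (h.measurable k) (h.measurable (k + 1))

lemma measurableSet_red (h : IsUrnProcess μ f a l α) (n : ℕ) :
    MeasurableSet {ω | α (n + 1) ω = redUpdate (α n ω) (l + n)} := by
  refine measurableSet_eq_fun (h.measurable _) ?_
  unfold redUpdate
  exact (((h.measurable n).const_mul _).add_const 1).div_const _

lemma measurableSet_blue (h : IsUrnProcess μ f a l α) (n : ℕ) :
    MeasurableSet {ω | α (n + 1) ω = blueUpdate (α n ω) (l + n)} := by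
  refine measurableSet_eq_fun (h.measurable _) ?_
  unfold blueUpdate
  exact ((h.measurable n).const_mul _).div_const _

lemma setIntegral_red [IsProbabilityMeasure μ] (h : IsUrnProcess μ f a l α) (n : ℕ) {A : Set Ω}
    (hA : MeasurableSet[history α n] A) :
    ∫ ω in A, f (α n ω) ∂μ = μ.real (A ∩ {ω | α (n + 1) ω = redUpdate (α n ω) (l + n)}) := by
  rw [← setIntegral_congr_ae₀ (f := μ⟦{ω | α (n + 1) ω = redUpdate (α n ω) (l + n)} | history α n⟧)
    ((h.history_le n) _ hA).nullMeasurableSet ((h.red n).mono fun ω hω _ => hω),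
    setIntegral_condExp (h.history_le n)
      ((integrable_const (1 : ℝ)).indicator (h.measurableSet_red n)) hA,
    setIntegral_indicator (h.measurableSet_red n)]
  simp

/-- The two events are disjoint, the updates differing by `1/(l + n + 1)`, and their conditional
probabilities add up to `1`. -/
lemma ae_red_or_blue [IsProbabilityMeasure μ] (h : IsUrnProcess μ f a l α) (hl : 0 < l) (n : ℕ) :
    ∀ᵐ ω ∂μ, α (n + 1) ω = redUpdate (α n ω) (l + n) ∨
      α (n + 1) ω = blueUpdate (α n ω) (l + n) := by
  have hR := h.measurableSet_red n
  have hB := h.measurableSet_blue n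
  have h1 := integral_condExp (μ := μ) (h.history_le n)
    (f := {ω | α (n + 1) ω = redUpdate (α n ω) (l + n)}.indicator fun _ => (1 : ℝ))
  have h2 := integral_condExp (μ := μ) (h.history_le n)
    (f := {ω | α (n + 1) ω = blueUpdate (α n ω) (l + n)}.indicator fun _ => (1 : ℝ))
  have hint : Integrable (fun ω => f (α n ω)) μ := integrable_condExp.congr (h.red n)
  rw [integral_congr_ae (h.red n), integral_indicator hR] at h1
  rw [integral_congr_ae (h.blue n), integral_indicator hB,
    integral_sub (integrable_const _) hint] at h2
  simp only [integral_const, probReal_univ, smul_eq_mul, mul_one, MeasurableSet.univ,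
    measureReal_restrict_apply, univ_inter] at h1 h2
  have hdisj : Disjoint {ω | α (n + 1) ω = redUpdate (α n ω) (l + n)}
      {ω | α (n + 1) ω = blueUpdate (α n ω) (l + n)} := by
    rw [Set.disjoint_left]
    intro ω hω1 hω2
    simp only [mem_ofPred_eq] at hω1 hω2
    rw [hω1] at hω2
    have hpos : (0 : ℝ) < l + n + 1 := by positivity
    unfold redUpdate blueUpdate at hω2
    rw [div_left_inj' hpos.ne'] at hω2
    linarith
  have h3 := measureReal_union (μ := μ) hdisj hB
  rw [← h1, ← h2, add_sub_cancel] at h3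
  have h4 : μ ({ω | α (n + 1) ω = redUpdate (α n ω) (l + n)} ∪
      {ω | α (n + 1) ω = blueUpdate (α n ω) (l + n)}) = 1 := by
    rw [← ENNReal.ofReal_one, ← h3, ofReal_measureReal]
  exact (mem_ae_iff_prob_eq_one (hR.union hB)).2 h4

lemma ae_eq_urnState [IsProbabilityMeasure μ] (h : IsUrnProcess μ f a l α) (hl : 0 < l) :
    ∀ᵐ ω ∂μ, ∀ n, α n ω = urnState a l n (draws l fun k => α k ω) := by
  have hstart : ∀ᵐ ω ∂μ, α 0 ω = a := by
    obtain ⟨-, h0, -, -⟩ := h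
    exact h0
  filter_upwards [hstart, ae_all_iff.2 (h.ae_red_or_blue hl)] with ω h0 hω n
  induction n with
  | zero => rw [h0, urnState_zero hl]
  | succ n ih =>
    rw [urnState_succ hl, ← ih]
    split_ifs with hd
    · exact draws_eq_true_iff.1 hd
    · exact (hω n).resolve_left fun h' => hd (draws_eq_true_iff.2 h')

lemma isDrawLaw [IsProbabilityMeasure μ] (h : IsUrnProcess μ f a l α)
    (ha : a ∈ Set.Icc (0 : ℝ) 1) (hl : 0 < l)
    (hf_range : ∀ p ∈ Set.Icc (0 : ℝ) 1, f p ∈ Set.Ioo (0 : ℝ) 1)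
    (hf_cont : ContinuousOn f (Set.Icc 0 1)) :
    IsDrawLaw (μ.map fun ω => draws l fun k => α k ω) (fun n s => f (urnState a l n s)) where
  dependsOn n s t hst := by
    change f _ = f _
    rw [dependsOn_urnState a l n hst]
  elliptic := by
    -- Compactness of `[0, 1]` turns `0 < f < 1` into uniform ellipticity, with constant `min (min
    -- f) (1 - max f)`.
    obtain ⟨p, hp, hmin⟩ := isCompact_Icc.exists_isMinOn
      (nonempty_Icc.2 (zero_le_one : (0 : ℝ) ≤ 1)) hf_cont
    obtain ⟨r, hr, hmax⟩ := isCompact_Icc.exists_isMaxOn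
      (nonempty_Icc.2 (zero_le_one : (0 : ℝ) ≤ 1)) hf_cont
    refine ⟨min (f p) (1 - f r), lt_min (hf_range p hp).1 (by linarith [(hf_range r hr).2]),
      fun n b => ⟨(min_le_left _ _).trans (hmin (urnState_mem ha hl n b)), ?_⟩⟩
    have h1 : f (urnState a l n b) ≤ f r := hmax (urnState_mem ha hl n b)
    have h2 := min_le_right (f p) (1 - f r)
    linarith
  draw n b := by
    rw [Measure.map_apply h.measurable_draws
        ((measurableSet_prefixSet b n).inter (measurableSet_draw n true)),
      Measure.map_apply h.measurable_draws (measurableSet_prefixSet b n)]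
    set A : Set Ω := (fun ω => draws l fun k => α k ω) ⁻¹' prefixSet b n with hA
    have hAm : MeasurableSet[history α n] A :=
      @measurableSet_draws_prefix Ω (history α n) l α n (fun j hj => measurable_history hj) b
    have hset : (fun ω => draws l fun k => α k ω) ⁻¹' (prefixSet b n ∩ {s | s n = true}) =
        A ∩ {ω | α (n + 1) ω = redUpdate (α n ω) (l + n)} := by
      ext ω
      simp only [hA, mem_preimage, mem_inter_iff, mem_ofPred_eq, draws_eq_true_iff]
    have h1 := h.setIntegral_red n hAm
    rw [setIntegral_congr_ae (g := fun _ => f (urnState a l n b)) ((h.history_le n) _ hAm)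
      ((h.ae_eq_urnState hl).mono fun ω hω hωA => by
        rw [hω n, dependsOn_urnState a l n (y := b) fun k hk => hωA k hk])] at h1
    rw [setIntegral_const, smul_eq_mul] at h1
    rw [hset, ← ofReal_measureReal, ← h1, ENNReal.ofReal_mul measureReal_nonneg,
      ofReal_measureReal]

end IsUrnProcess

lemma reds_decide_lt (r n : ℕ) : reds n (fun k => decide (k < r)) = min r n := by
  induction n with
  | zero => simp [reds_zero]
  | succ n ih =>
    rw [reds_succ, ih]
    simp only [decide_eq_true_eq]
    split_ifs <;> omega

lemma tendsto_urnState (a l : ℝ) {t : ℝ} (ht : 0 ≤ t) (c : ℕ) :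
    Tendsto (fun N : ℕ => (l * a + (⌊t * N⌋₊ + c : ℕ)) / (l + (N + c : ℕ))) atTop (𝓝 t) := by
  have hnat : Tendsto (fun N : ℕ => (N : ℝ)) atTop atTop := tendsto_natCast_atTop_atTop
  have h1 : Tendsto (fun N : ℕ => (⌊t * N⌋₊ : ℝ) / N) atTop (𝓝 t) :=
    (tendsto_nat_floor_mul_div_atTop ht).comp hnat
  have h2 : Tendsto (fun N : ℕ => (l * a + c) / (N : ℝ)) atTop (𝓝 0) :=
    tendsto_const_nhds.div_atTop hnat
  have h3 : Tendsto (fun N : ℕ => (l + c) / (N : ℝ)) atTop (𝓝 0) :=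
    tendsto_const_nhds.div_atTop hnat
  have h4 := (h1.add h2).div (h3.const_add 1) (by norm_num)
  simp only [add_zero, div_one] at h4
  refine h4.congr' ?_
  filter_upwards [eventually_gt_atTop 0] with N hN
  have hN' : (N : ℝ) ≠ 0 := by positivity
  simp only [Pi.div_apply]
  rw [← add_div, show (1 : ℝ) + (l + c) / N = (N + (l + c)) / N by field_simp,
    div_div_div_cancel_right₀ hN']
  push_cast
  congr 1 <;> ring

/-- The total drift of an urn is never exhausted at a given red draw. -/
lemma driftUpTo_lt_one {ν : Measure (ℕ → Bool)} [IsProbabilityMeasure ν] {f : ℝ → ℝ} {a l : ℝ}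
    (h : IsDrawLaw ν fun n s => f (urnState a l n s)) (ha : a ∈ Set.Icc (0 : ℝ) 1) (hl : 0 < l)
    (hf_cont : ContinuousOn f (Set.Icc 0 1))
    (htop : driftUpTo ν (fun n s => f (urnState a l n s)) ⊤ ≤ 1) (y : ℕ) :
    driftUpTo ν (fun n s => f (urnState a l n s)) y < 1 := by
  by_cases hall : ∀ t ∈ Set.Icc (0 : ℝ) 1, f t ≤ 1 / 2
  · rw [IsDrawLaw.driftUpTo_eq_zero fun n b => hall _ (urnState_mem ha hl n b)]
    exact zero_lt_one
  push Not at hall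
  obtain ⟨t, ht, hft⟩ := hall
  -- The prefix has `⌊tN⌋ + y + 1` red draws and then only blue ones: the proportion tends to `t`,
  -- where the drift is positive, and the extra `y + 1` reds carry it past the `(y + 1)`-th red
  -- draw.
  have hreds : ∀ N : ℕ, reds (N + (y + 1)) (fun k => decide (k < ⌊t * N⌋₊ + (y + 1))) =
      ⌊t * N⌋₊ + (y + 1) := by
    intro N
    rw [reds_decide_lt, min_eq_left]
    have : ⌊t * N⌋₊ ≤ N := Nat.floor_le_of_le (by nlinarith [ht.2, (Nat.cast_nonneg N : (0 : ℝ) ≤ N)])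
    omega
  have hlim : Tendsto (fun N : ℕ => urnState a l (N + (y + 1))
      (fun k => decide (k < ⌊t * N⌋₊ + (y + 1)))) atTop (𝓝[Set.Icc 0 1] t) := by
    refine tendsto_nhdsWithin_iff.2 ⟨?_, Eventually.of_forall fun N => urnState_mem ha hl _ _⟩
    simp only [urnState, hreds]
    exact tendsto_urnState a l ht.1 (y + 1)
  obtain ⟨N, hN⟩ := (((hf_cont t ht).tendsto.comp hlim).eventually (lt_mem_nhds hft)).exists
  have hadd := h.driftUpTo_add_le (y := y) (n := N + (y + 1))
    (b := fun k => decide (k < ⌊t * N⌋₊ + (y + 1))) (by rw [hreds]; omega)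
  have hpos : 0 < ENNReal.ofReal (2 * f (urnState a l (N + (y + 1))
      (fun k => decide (k < ⌊t * N⌋₊ + (y + 1)))) - 1) *
      ν (prefixSet (fun k => decide (k < ⌊t * N⌋₊ + (y + 1))) (N + (y + 1))) :=
    ENNReal.mul_pos (ENNReal.ofReal_pos.2 (by simp only [Function.comp_apply] at hN; linarith)).ne'
      (h.prefixSet_pos _ _).ne'
  have hne : driftUpTo ν (fun n s => f (urnState a l n s)) y ≠ ⊤ :=
    ne_top_of_le_ne_top ENNReal.one_ne_top (((IsDrawLaw.driftUpTo_mono) le_top).trans htop)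
  exact lt_of_lt_of_le (ENNReal.lt_add_right hne hpos.ne') (hadd.trans htop)

lemma lintegral_totalDrift {Ω : Type*} [MeasurableSpace Ω] {μ : Measure Ω} [IsProbabilityMeasure μ]
    {f : ℝ → ℝ} {a l : ℝ} {α : ℕ → Ω → ℝ} (h : IsUrnProcess μ f a l α) (hl : 0 < l)
    (hlaw : IsDrawLaw (μ.map fun ω => draws l fun k => α k ω) fun n s => f (urnState a l n s)) :
    ∫⁻ ω, totalDrift f (fun k => α k ω) ∂μ =
      driftUpTo (μ.map fun ω => draws l fun k => α k ω) (fun n s => f (urnState a l n s)) ⊤ := by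
  rw [driftUpTo, lintegral_map (Measurable.tsum fun k => hlaw.measurable_drift_term _ k)
    h.measurable_draws]
  refine lintegral_congr_ae ?_
  filter_upwards [h.ae_eq_urnState hl] with ω hω
  refine tsum_congr fun k => ?_
  rw [if_pos le_top, ← hω k]

/-! ### The recurrence criterion -/

theorem theorem1 {Ω : Type*} [MeasurableSpace Ω] (μ : Measure Ω) [IsProbabilityMeasure μ]
    (f : ℝ → ℝ)
    (hf_range : ∀ p ∈ Set.Icc (0 : ℝ) 1, f p ∈ Set.Ioo (0 : ℝ) 1)
    (hf_smooth : ContDiffOn ℝ 3 f (Set.Icc 0 1))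
    (hf_isolated : ∀ p ∈ Set.Icc (0 : ℝ) 1, f p = p →
      ∀ᶠ q in 𝓝[Set.Icc (0 : ℝ) 1 \ {p}] p, f q ≠ q)
    (hf_half : ∀ p ∈ Set.Icc (0 : ℝ) 1, 1 / 2 ≤ f p)
    (a₀ l₀ : ℤ → ℝ)
    (ha₀ : ∀ x, a₀ x ∈ Set.Icc (0 : ℝ) 1) (hl₀ : ∀ x, 0 < l₀ x)
    (hw : ∀ x : ℤ, 1 ≤ x → a₀ x = a₀ 1 ∧ l₀ x = l₀ 1)
    (α : ℤ → ℕ → Ω → ℝ) (X : ℕ → Ω → ℤ)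
    (hX : IsReinforcedWalk μ f a₀ l₀ 0 α X) :
    ((∀ᵐ ω ∂μ, IsRecurrentPath (fun n => X n ω)) ∨
      (∀ᵐ ω ∂μ, IsTransientPath (fun n => X n ω))) ∧
    ((∀ᵐ ω ∂μ, IsRecurrentPath (fun n => X n ω)) ↔
      ∫⁻ ω, totalDrift f (fun k => α 1 k ω) ∂μ ≤ 1) := by
  have hcont := hf_smooth.continuousOn
  set s : ℤ → Ω → ℕ → Bool := fun x ω => draws (l₀ x) fun k => α x k ω with hs
  have hsm : ∀ x, Measurable (s x) := fun x => (hX.urn x).measurable_draws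
  have hlaw : ∀ x, IsDrawLaw (μ.map (s x)) fun n b => f (urnState (a₀ x) (l₀ x) n b) := fun x =>
    (hX.urn x).isDrawLaw (ha₀ x) (hl₀ x) hf_range hcont
  have hprob : ∀ x, IsProbabilityMeasure (μ.map (s x)) := fun x =>
    Measure.isProbabilityMeasure_map (hsm x).aemeasurable
  have hindep : iIndepFun s μ := by
    refine hX.indep.comp (fun x β => draws (l₀ x) β) fun x => ?_
    exact measurable_pi_lambda _ fun k =>
      _root_.measurable_draws (Ω := ℕ → ℝ) (α := fun n β => β n) (l₀ x) (measurable_pi_apply k)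
        (measurable_pi_apply (k + 1))
  have hdriven : ∀ ω, IsDriven (fun x => s x ω) (fun n => X n ω) := by
    refine fun ω => ⟨hX.start ω, fun n => ?_⟩
    rw [hX.step n ω (X n ω) _ rfl rfl]
    simp only [hs, draws_eq_true_iff]
  have hmixed : ∀ᵐ ω ∂μ, ∀ x, IsMixed (s x ω) :=
    ae_all_iff.2 fun x => ae_of_ae_map (hsm x).aemeasurable (hlaw x).ae_isMixed
  -- the draws at the sites to the right of the origin
  set S : ℕ → Ω → ℕ → Bool := fun i => s (1 + i) with hS
  have hSm : ∀ i, Measurable (S i) := fun i => hsm _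
  have hSi : iIndepFun S μ := hindep.precomp (g := fun i : ℕ => (1 : ℤ) + i) fun i j hij => by
    simpa using hij
  -- Equal initial urns give equal conditional probabilities, and these determine the law of the
  -- draws.
  have hSν : ∀ i, μ.map (S i) = μ.map (s 1) := by
    intro i
    have h := hlaw (1 + i)
    rw [(hw (1 + i) (by omega)).1, (hw (1 + i) (by omega)).2] at h
    exact h.unique (hlaw 1)
  -- the draws to the left of the origin, with colours exchanged
  have hleft : ∀ᵐ ω ∂μ, backwardLim (fun (i : ℕ) k => !s (-(1 + i)) ω k) = ⊤ := by
    refine ae_backwardLim_eq_top_of_le_half (S := fun (i : ℕ) ω k => !s (-(1 + i)) ω k)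
      (fun i => measurable_flip.comp (hsm _)) ?_ fun i => ?_
    · exact (hindep.precomp (g := fun i : ℕ => -((1 : ℤ) + i)) fun i j hij => by
        simpa using hij).comp (fun _ b k => !b k) fun _ => measurable_flip
    · have h := (hlaw (-(1 + i))).flip
      rw [Measure.map_map measurable_flip (hsm _)] at h
      refine ⟨_, h, fun n b => ?_⟩
      have := hf_half _ (urnState_mem (ha₀ (-(1 + i))) (hl₀ (-(1 + i))) n fun k => !b k)
      linarith
  have hpath : ∀ᵐ ω ∂μ, (IsRecurrentPath (fun n => X n ω) ∧ backwardLim (fun i => S i ω) = ⊤) ∨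
      (Tendsto (fun n => X n ω) atTop atTop ∧ backwardLim (fun i => S i ω) < ⊤) := by
    filter_upwards [hmixed, hleft] with ω h1 h2
    rcases (hdriven ω).recurrent_or_tendsto h1 with h | h | h
    · exact Or.inl ⟨h, (hdriven ω).backwardLim_eq_top (h1 1) h⟩
    · exact Or.inr ⟨h, (hdriven ω).backwardLim_lt_top h⟩
    -- Convergence to `-∞` would make the reflected recursion finite, contrary to `hleft`.
    · have := (hdriven ω).neg.backwardLim_lt_top (tendsto_neg_atBot_atTop.comp h)
      exact absurd h2 this.ne
  have hdrift := lintegral_totalDrift (hX.urn 1) (hl₀ 1) (hlaw 1)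
  rw [hdrift]
  rcases ae_backwardLim_zero_one hSm hSi fun i => ⟨_, hlaw (1 + i)⟩ with htop | hlt
  · have hrec : ∀ᵐ ω ∂μ, IsRecurrentPath (fun n => X n ω) := by
      filter_upwards [hpath, htop] with ω h1 h2
      rcases h1 with h | h
      · exact h.1
      · exact absurd h2 h.2.ne
    exact ⟨Or.inl hrec, iff_of_true hrec (driftUpTo_top_le_one hSm hSi hSν (hlaw 1)
      (fun n b => hf_half _ (urnState_mem (ha₀ 1) (hl₀ 1) n b)) htop)⟩
  · have htrans : ∀ᵐ ω ∂μ, Tendsto (fun n => X n ω) atTop atTop := by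
      filter_upwards [hpath, hlt] with ω h1 h2
      rcases h1 with h | h
      · exact absurd h.2 h2.ne
      · exact h.1
    refine ⟨Or.inr (htrans.mono fun ω h => Or.inl h), iff_of_false (fun hrec => ?_) fun hle => ?_⟩
    · obtain ⟨ω, h1, h2⟩ := (hrec.and htrans).exists
      obtain ⟨n, hn1, hn2⟩ := ((h1 0).and_eventually (h2.eventually_gt_atTop 0)).exists
      exact absurd hn1 hn2.ne'
    · exact not_ae_backwardLim_lt_top hSm hSi hSν (hlaw 1)
        (driftUpTo_lt_one (hlaw 1) (ha₀ 1) (hl₀ 1) hcont hle) hlt
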